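/- Let $\mathbb Q_+=\mathbb Q\cap(0,\infty)$. A rational-time subproduct system of two-dimensional Hilbert spaces consists of two-dimensional complex Hilbert spaces $E_t$ ($t\in\mathbb Q_+$) and isometric linear maps $\beta_{s,t}:E_{s+t}\to E_s\otimes E_t$ ($s,t\in\mathbb Q_+$) such that $$(\beta_{r,s}\otimes 1_{E_t})\,\beta_{r+s,t}=(1_{E_r}\otimes\beta_{s,t})\,\beta_{r,s+t}\qquad\text{for all } r,s,t\in\mathbb Q_+ .$$ **Theorem 3.1.** For every rational-time subproduct system $(E_t,\beta_{s,t})$ of two-dimensional Hilbert spaces there exist vectors $x_t,y_t\in E_t$ ($t\in\mathbb Q_+$) such that one and only one of the following four conditions (numbered 1, 3, 4, 5) is satisfied. (1) There exists $a\in[0,1)$ such that for all $s,t\in\mathbb Q_+$ $$\|x_t\|=\|y_t\|=1,\quad \langle x_t,y_t\rangle=a^t,\quad \beta_{s,t}(x_{s+t})=x_s\otimes x_t,\quad \beta_{s,t}(y_{s+t})=y_s\otimes y_t .$$ (3) There exist $c\in(0,\infty)$ and complex numbers $\eta_t$ ($t\in\mathbb Q_+$) such that for all $s,t\in\mathbb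 Q_+$ one has $|\eta_t|=1$, $\eta_{s+t}=\eta_s\eta_t$ and $$\|x_t\|=1,\quad \langle x_t,y_t\rangle=0,\quad \|y_t\|^2=\begin{cases}t&\text{if }c=1,\\ (c^{2t}-1)/(c^2-1)&\text{if }c\neq1,\end{cases}$$ $$\beta_{s,t}(x_{s+t})=x_s\otimes x_t,\quad \beta_{s,t}(y_{s+t})=y_s\otimes x_t+c^s\eta_s\,x_s\otimes y_t .$$ (4) For all $s,t\in\mathbb Q_+$ $$\|x_t\|=\|y_t\|=1,\quad \langle x_t,y_t\rangle=0,\quad \beta_{s,t}(x_{s+t})=x_s\otimes x_t,\quad \beta_{s,t}(y_{s+t})=y_s\otimes x_t .$$ (5) For all $s,t\in\mathbb Q_+$ $$\|x_t\|=\|y_t\|=1,\quad \langle x_t,y_t\rangle=0,\quad \beta_{s,t}(x_{s+t})=x_s\otimes x_t,\quad \beta_{s,t}(y_{s+t})=x_s\otimes y_t .$$ Moreover, the number of the condition depends only on the system: if two choices of vectors $(x_t,y_t)_t$ and $(x'_t,y'_t)_t$ for the same system satisfy conditions number $k$ and $k'$ respectively, then $k=k'$. Finally, type $\mathcal E_2$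 cannot occur: for no $r\in\mathbb Q_+$ are there $a\in[0,1)$ and vectors $x_n,y_n\in E_{nr}$ ($n=1,2,\dots$) such that for all $m,n\in\{1,2,\dots\}$ $$\|x_n\|=\|y_n\|=1,\quad \langle x_n,y_n\rangle=a^n,$$ $$\beta_{mr,nr}(x_{m+n})=\begin{cases}x_m\otimes x_n&(m\text{ even}),\\ x_m\otimes y_n&(m\text{ odd}),\end{cases}\qquad \beta_{mr,nr}(y_{m+n})=\begin{cases}y_m\otimes y_n&(m\text{ even}),\\ y_m\otimes x_n&(m\text{ odd}).\end{cases}$$ -/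

import Mathlib

open scoped TensorProduct

/-- A subproduct system of two-dimensional Hilbert spaces over `ℂ`, with time running over an additive
semigroup `T` (positive integers: discrete time; positive rationals: rational time).

The map `β_{s,t} : E_{s+t} → E_s ⊗ E_t` is indexed by `s`, `t` and a name `p` for `s + t`, so that
associativity needs no transport between `E_{(r+s)+t}` and `E_{r+(s+t)}`; taking `p := s + t` and
`h := rfl` gives `β_{s,t}` itself and carries all the information. -/
structure SubproductSystem.{u, v} (T : Type u) [AddSemigroup T] where
  E : T → Type v
  [normedAddCommGroup : ∀ t, NormedAddCommGroup (E t)]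
  [innerProductSpace : ∀ t, InnerProductSpace ℂ (E t)]
  /-- each space is two-dimensional (hence complete) -/
  finrank_eq_two : ∀ t, Module.finrank ℂ (E t) = 2
  /-- the isometric linear maps `β_{s,t}` into the Hilbert tensor product -/
  β : ∀ (s t : T) {p : T}, s + t = p → (E p →ₗᵢ[ℂ] E s ⊗[ℂ] E t)
  /-- `(β_{r,s} ⊗ 1) ∘ β_{r+s,t} = (1 ⊗ β_{s,t}) ∘ β_{r,s+t}`, up to the canonical identification
  of `(E_r ⊗ E_s) ⊗ E_t` with `E_r ⊗ (E_s ⊗ E_t)` -/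
  assoc : ∀ (r s t : T) {p q w : T} (hp : r + s = p) (hw : p + t = w) (hq : s + t = q)
    (hw' : r + q = w) (u : E w),
    TensorProduct.assoc ℂ (E r) (E s) (E t)
        (TensorProduct.map (β r s hp).toLinearMap LinearMap.id (β p t hw u)) =
      TensorProduct.map LinearMap.id (β s t hq).toLinearMap (β r q hw' u)

namespace SubproductSystem

attribute [instance] normedAddCommGroup innerProductSpace

/-- Change of time along a homomorphism `f : S → T`: the system `(E_{f t}, β_{f s, f t})`. -/
def comap {S T : Type*} [AddSemigroup S] [AddSemigroup T] (A : SubproductSystem T)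
    (f : S →ₙ+ T) : SubproductSystem S where
  E t := A.E (f t)
  finrank_eq_two t := A.finrank_eq_two (f t)
  β s t _ h := A.β (f s) (f t) (by rw [← map_add, h])
  assoc r s t _ _ _ _ _ _ _ u := A.assoc (f r) (f s) (f t) _ _ _ _ u

end SubproductSystem

/-- The positive rational numbers. -/
abbrev QPos : Type := {q : ℚ // 0 < q}

/-- The lattice `n ↦ n r` of positive integer multiples of a positive rational `r`. -/
def QPos.multiples (r : QPos) : ℕ+ →ₙ+ QPos where
  toFun n := ⟨(n : ℕ) * (r : ℚ), mul_pos (Nat.cast_pos.mpr n.pos) r.2⟩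
  map_add' m n := Subtype.ext (by simp [add_mul])

/-- A rational-time subproduct system of two-dimensional Hilbert spaces. -/
abbrev RationalSubproductSystem.{v} : Type (v + 1) := SubproductSystem.{0, v} QPos

/-- A discrete-time subproduct system of two-dimensional Hilbert spaces. -/
abbrev DiscreteSubproductSystem.{v} : Type (v + 1) := SubproductSystem.{0, v} ℕ+

/-- The restriction `(E_{nr})_{n = 1, 2, …}` to the lattice of positive integer multiples of `r`. -/
def RationalSubproductSystem.restrict (A : RationalSubproductSystem) (r : QPos) :
    DiscreteSubproductSystem :=
  A.comap r.multiples

/-- The vectors `x_t, y_t` form a basis of the discrete-time type `𝓔₂(a)` for some `a ∈ [0, 1)`. -/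
def DiscreteSubproductSystem.IsType2 (A : DiscreteSubproductSystem) (x y : ∀ t, A.E t) : Prop :=
  ∃ a : ℝ, 0 ≤ a ∧ a < 1 ∧ ∀ s t : ℕ+,
    ‖x t‖ = 1 ∧ ‖y t‖ = 1 ∧ inner ℂ (x t) (y t) = ((a ^ (t : ℕ) : ℝ) : ℂ) ∧
    A.β s t rfl (x (s + t)) = (if Even (s : ℕ) then x s ⊗ₜ[ℂ] x t else x s ⊗ₜ[ℂ] y t) ∧
    A.β s t rfl (y (s + t)) = (if Even (s : ℕ) then y s ⊗ₜ[ℂ] y t else y s ⊗ₜ[ℂ] x t)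

namespace RationalSubproductSystem

/-- Normal form (1). -/
def IsType1 (A : RationalSubproductSystem) (x y : ∀ t, A.E t) : Prop :=
  ∃ a : ℝ, 0 ≤ a ∧ a < 1 ∧ ∀ s t : QPos,
    ‖x t‖ = 1 ∧ ‖y t‖ = 1 ∧ inner ℂ (x t) (y t) = ((a ^ ((t : ℚ) : ℝ) : ℝ) : ℂ) ∧
    A.β s t rfl (x (s + t)) = x s ⊗ₜ[ℂ] x t ∧
    A.β s t rfl (y (s + t)) = y s ⊗ₜ[ℂ] y t

open Classical in
/-- Normal form (3). -/
def IsType3 (A : RationalSubproductSystem) (x y : ∀ t, A.E t) : Prop :=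
  ∃ (c : ℝ) (η : QPos → ℂ), 0 < c ∧ ∀ s t : QPos,
    ‖η t‖ = 1 ∧ η (s + t) = η s * η t ∧
    ‖x t‖ = 1 ∧ inner ℂ (x t) (y t) = 0 ∧
    ‖y t‖ ^ 2 = (if c = 1 then ((t : ℚ) : ℝ)
      else (c ^ (2 * ((t : ℚ) : ℝ)) - 1) / (c ^ 2 - 1)) ∧
    A.β s t rfl (x (s + t)) = x s ⊗ₜ[ℂ] x t ∧
    A.β s t rfl (y (s + t)) =
      y s ⊗ₜ[ℂ] x t + (((c ^ ((s : ℚ) : ℝ) : ℝ) : ℂ) * η s) • (x s ⊗ₜ[ℂ] y t)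

/-- Normal form (4). -/
def IsType4 (A : RationalSubproductSystem) (x y : ∀ t, A.E t) : Prop :=
  ∀ s t : QPos,
    ‖x t‖ = 1 ∧ ‖y t‖ = 1 ∧ inner ℂ (x t) (y t) = 0 ∧
    A.β s t rfl (x (s + t)) = x s ⊗ₜ[ℂ] x t ∧
    A.β s t rfl (y (s + t)) = y s ⊗ₜ[ℂ] x t

/-- Normal form (5). -/
def IsType5 (A : RationalSubproductSystem) (x y : ∀ t, A.E t) : Prop :=
  ∀ s t : QPos,
    ‖x t‖ = 1 ∧ ‖y t‖ = 1 ∧ inner ℂ (x t) (y t) = 0 ∧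
    A.β s t rfl (x (s + t)) = x s ⊗ₜ[ℂ] x t ∧
    A.β s t rfl (y (s + t)) = x s ⊗ₜ[ℂ] y t

/-- The labels 1, 3, 4, 5 of the four normal forms. -/
inductive NormalForm
  | one | three | four | five

/-- The vectors `x_t, y_t` are in the normal form with the given label. -/
def IsBasis (A : RationalSubproductSystem) (x y : ∀ t, A.E t) : NormalForm → Prop
  | .one => A.IsType1 x y
  | .three => A.IsType3 x y
  | .four => A.IsType4 x y
  | .five => A.IsType5 x y

end RationalSubproductSystem

/-! The range of `β_{r,r}` is a plane in `E_r ⊗ E_r`, and almost everything is read off from it.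
Over `ℂ` a plane of tensors contains a nonzero product, which leaves four shapes: spanned by two
products with independent factors, tangent to the products at `a ⊗ b`, or one factor fixed on the
left or on the right (`pencil_normal_form`). Associativity at time `3r` forces left and right
factors to match (`factor_of_two_products`, `factor_of_tangent`). Hence some basis `x, y` of `E_r`
makes the plane either the span of `x ⊗ x` and `p y ⊗ x + q x ⊗ y + k y ⊗ y` with `(p, q, k)` equal
to `(0, 0, 1)`, `(1, q, 0)` or `(0, 1, 0)`, or the span of `x ⊗ y` and `y ⊗ x`
(`exists_basis_diagonal`). In the first case associativity propagates the pattern to all multiples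
of `r`, with `q` replaced by `q ^ s` at time `s r` (`exists_multiplies`).

The alternating plane contains no nonzero square `z ⊗ z`. In an alternating discrete system,
however, `x_4` splits as `x_2 ⊗ x_2`, so at even times there is always a square
(`exists_square_two`). Every positive rational is twice another, so the alternating case, and with
it type 2, never occurs in rational time.

The type and its real parameter (the overlap `a`, or `c = |q|`) are invariants of the plane at time
1 (`NormalOn.parameter_eq`); this gives uniqueness. It also makes the normal forms found on the
lattices `(1/n!) ℕ+`, which all contain 1, share one parameter. The vectors and the phases of `q`
may differ from lattice to lattice, but at each time they range over compact sets, so a limit along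
an ultrafilter yields a normal form on all of `ℚ_+` (`exists_normalOn_univ`). -/

open Filter Topology

/-! ### Planes of tensors in a product of two-dimensional spaces -/

section LinearAlgebra

variable {E F W : Type*} [AddCommGroup E] [Module ℂ E] [AddCommGroup F] [Module ℂ F]
  [AddCommGroup W] [Module ℂ W]

theorem exists_dual_pair (hE : Module.finrank ℂ E = 2) {x y : E}
    (h : LinearIndependent ℂ ![x, y]) :
    ∃ φ ψ : E →ₗ[ℂ] ℂ, φ x = 1 ∧ φ y = 0 ∧ ψ x = 0 ∧ ψ y = 1 ∧
      ∀ u, u = φ u • x + ψ u • y := by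
  let b := basisOfLinearIndependentOfCardEqFinrank h (by simp [hE])
  have b0 : b 0 = x := by simp [b]
  have b1 : b 1 = y := by simp [b]
  refine ⟨b.coord 0, b.coord 1, ?_, ?_, ?_, ?_, fun u => ?_⟩
  · rw [← b0]; simp
  · rw [← b1]; simp
  · rw [← b0]; simp
  · rw [← b1]; simp
  · conv_lhs => rw [← b.sum_repr u]
    rw [Fin.sum_univ_two, b0, b1]; rfl

theorem exists_pair_coords (hE : Module.finrank ℂ E = 2) {x y : E}
    (h : LinearIndependent ℂ ![x, y]) (u : E) : ∃ α γ : ℂ, u = α • x + γ • y := by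
  obtain ⟨φ, ψ, -, -, -, -, hu⟩ := exists_dual_pair hE h
  exact ⟨_, _, hu u⟩

theorem exists_tmul_add_tmul (hE : Module.finrank ℂ E = 2) {x y : E}
    (h : LinearIndependent ℂ ![x, y]) (w : E ⊗[ℂ] F) :
    ∃ f g : F, w = x ⊗ₜ[ℂ] f + y ⊗ₜ[ℂ] g := by
  obtain ⟨φ, ψ, -, -, -, -, hu⟩ := exists_dual_pair hE h
  induction w with
  | zero => exact ⟨0, 0, by simp⟩
  | add a b ha hb =>
    obtain ⟨f, g, rfl⟩ := ha
    obtain ⟨f', g', rfl⟩ := hb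
    exact ⟨f + f', g + g', by simp only [TensorProduct.tmul_add]; abel⟩
  | tmul a b =>
    refine ⟨φ a • b, ψ a • b, ?_⟩
    conv_lhs => rw [hu a]
    simp [TensorProduct.add_tmul, TensorProduct.smul_tmul]

theorem tmul_add_tmul_inj (hE : Module.finrank ℂ E = 2) {x y : E}
    (h : LinearIndependent ℂ ![x, y]) {f g f' g' : F}
    (e : x ⊗ₜ[ℂ] f + y ⊗ₜ[ℂ] g = x ⊗ₜ[ℂ] f' + y ⊗ₜ[ℂ] g') : f = f' ∧ g = g' := by
  obtain ⟨φ, ψ, h1, h2, h3, h4, -⟩ := exists_dual_pair hE h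
  constructor
  · simpa [h1, h2] using congrArg ((TensorProduct.lid ℂ F).toLinearMap ∘ₗ LinearMap.rTensor F φ) e
  · simpa [h3, h4] using congrArg ((TensorProduct.lid ℂ F).toLinearMap ∘ₗ LinearMap.rTensor F ψ) e

theorem pair_coords_inj {x y : E} (h : LinearIndependent ℂ ![x, y]) {a b a' b' : ℂ}
    (e : a • x + b • y = a' • x + b' • y) : a = a' ∧ b = b' := by
  have := LinearIndependent.pair_iff.1 h (a - a') (b - b') (by
    rw [sub_smul, sub_smul]; rw [← sub_eq_zero] at e; rw [← e]; abel)
  exact ⟨sub_eq_zero.1 this.1, sub_eq_zero.1 this.2⟩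

theorem tensor_coords_inj (hE : Module.finrank ℂ E = 2) {x y : E} {x' y' : F}
    (h : LinearIndependent ℂ ![x, y]) (h' : LinearIndependent ℂ ![x', y'])
    {a b c d a' b' c' d' : ℂ}
    (e : a • x ⊗ₜ[ℂ] x' + b • x ⊗ₜ[ℂ] y' + c • y ⊗ₜ[ℂ] x' + d • y ⊗ₜ[ℂ] y' =
      a' • x ⊗ₜ[ℂ] x' + b' • x ⊗ₜ[ℂ] y' + c' • y ⊗ₜ[ℂ] x' + d' • y ⊗ₜ[ℂ] y') :
    (a = a' ∧ b = b') ∧ c = c' ∧ d = d' := by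
  have := tmul_add_tmul_inj hE h (f := a • x' + b • y') (g := c • x' + d • y')
    (f' := a' • x' + b' • y') (g' := c' • x' + d' • y') (by
      simpa [TensorProduct.tmul_add, ← add_assoc] using e)
  exact ⟨pair_coords_inj h' this.1, pair_coords_inj h' this.2⟩

theorem linearIndependent_pair_of_map {f : W →ₗ[ℂ] F} {u v : W}
    (h : LinearIndependent ℂ ![f u, f v]) : LinearIndependent ℂ ![u, v] := by
  rw [LinearIndependent.pair_iff] at h ⊢
  intro s t e
  exact h s t (by simpa using congrArg f e)

/-- An injective map out of a two-dimensional space whose range lies in the span of two vectors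
attains both of them. -/
theorem exists_preimages_of_range_le (hW : Module.finrank ℂ W = 2) {f : W →ₗ[ℂ] F}
    (hf : Function.Injective f) {P Q : F} (h : ∀ u, ∃ α γ : ℂ, f u = α • P + γ • Q) :
    ∃ u v, f u = P ∧ f v = Q := by
  have hle : LinearMap.range f ≤ Submodule.span ℂ {P, Q} := by
    rintro _ ⟨u, rfl⟩
    obtain ⟨α, γ, e⟩ := h u
    exact Submodule.mem_span_pair.2 ⟨α, γ, e.symm⟩
  have hfin : Module.Finite ℂ (Submodule.span ℂ ({P, Q} : Set F)) :=
    FiniteDimensional.span_of_finite ℂ (Set.toFinite _)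
  have hcard : Module.finrank ℂ (Submodule.span ℂ ({P, Q} : Set F)) ≤ 2 := by
    classical
    have := finrank_span_finset_le_card (R := ℂ) ({P, Q} : Finset F)
    rw [Finset.coe_pair] at this
    exact this.trans Finset.card_le_two
  have heq := Submodule.eq_of_le_of_finrank_le hle (by
    rw [LinearMap.finrank_range_of_inj hf, hW]; exact hcard)
  have hP : P ∈ LinearMap.range f := by
    rw [heq]; exact Submodule.subset_span (by simp)
  have hQ : Q ∈ LinearMap.range f := by
    rw [heq]; exact Submodule.subset_span (by simp)
  obtain ⟨u, hu⟩ := hP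
  obtain ⟨v, hv⟩ := hQ
  exact ⟨u, v, hu, hv⟩

theorem not_range_le_line (hW : Module.finrank ℂ W = 2) {f : W →ₗ[ℂ] F}
    (hf : Function.Injective f) (P : F) : ¬ ∀ u, ∃ α : ℂ, f u = α • P := by
  intro H
  have : Nontrivial W := Module.nontrivial_of_finrank_pos (R := ℂ) (by omega)
  obtain ⟨u, hu⟩ := exists_ne (0 : W)
  obtain ⟨v, huv⟩ := exists_linearIndependent_pair_of_one_lt_finrank (R := ℂ)
    (by omega : 1 < Module.finrank ℂ W) hu
  obtain ⟨α, hα⟩ := H u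
  obtain ⟨γ, hγ⟩ := H v
  have := LinearIndependent.pair_iff.1 huv γ (-α) (hf (by
    simp only [map_add, map_smul, map_zero, hα, hγ]; module))
  exact hu (hf (by rw [hα, neg_eq_zero.1 this.2]; simp))

theorem exists_pair_extending (hE : Module.finrank ℂ E = 2) {x : E} (hx : x ≠ 0) :
    ∃ y, LinearIndependent ℂ ![x, y] := by
  obtain ⟨y, hy⟩ := exists_linearIndependent_pair_of_one_lt_finrank (R := ℂ) (by omega) hx
  exact ⟨y, hy⟩

/-- Write `f w = x ⊗ p w + y ⊗ q w`. If `q` is singular, a kernel vector gives `x ⊗ p w`; otherwise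
an eigenvector of `q⁻¹ p` with eigenvalue `μ` gives `(μ x + y) ⊗ q w`. This is where algebraic
closedness of `ℂ` enters. -/
theorem exists_ne_zero_map_eq_tmul (hE : Module.finrank ℂ E = 2) (hF : Module.finrank ℂ F = 2)
    (hW : Module.finrank ℂ W = 2) {f : W →ₗ[ℂ] E ⊗[ℂ] F} (hf : Function.Injective f) :
    ∃ w a b, f w = a ⊗ₜ[ℂ] b ∧ w ≠ 0 ∧ a ≠ 0 ∧ b ≠ 0 := by
  have : Nontrivial E := Module.nontrivial_of_finrank_pos (R := ℂ) (by omega)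
  have : Nontrivial W := Module.nontrivial_of_finrank_pos (R := ℂ) (by omega)
  have : FiniteDimensional ℂ W := Module.finite_of_finrank_pos (by omega)
  have : FiniteDimensional ℂ F := Module.finite_of_finrank_pos (by omega)
  obtain ⟨x, hx⟩ := exists_ne (0 : E)
  obtain ⟨y, hxy⟩ := exists_pair_extending hE hx
  obtain ⟨φ, ψ, h1, h2, h3, h4, -⟩ := exists_dual_pair hE hxy
  suffices h : ∃ w a b, f w = a ⊗ₜ[ℂ] b ∧ w ≠ 0 by
    obtain ⟨w, a, b, e, hw⟩ := h
    refine ⟨w, a, b, e, hw, ?_, ?_⟩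
    · rintro rfl; exact hw (hf (by simpa using e))
    · rintro rfl; exact hw (hf (by simpa using e))
  let p : W →ₗ[ℂ] F := (TensorProduct.lid ℂ F).toLinearMap ∘ₗ LinearMap.rTensor F φ ∘ₗ f
  let q : W →ₗ[ℂ] F := (TensorProduct.lid ℂ F).toLinearMap ∘ₗ LinearMap.rTensor F ψ ∘ₗ f
  have key : ∀ w, f w = x ⊗ₜ[ℂ] p w + y ⊗ₜ[ℂ] q w := by
    intro w
    obtain ⟨u, v, e⟩ := exists_tmul_add_tmul hE hxy (f w)
    simp [p, q, e, h1, h2, h3, h4]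
  by_cases hq : Function.Injective q
  · let Q := LinearEquiv.ofInjectiveOfFinrankEq q hq (by rw [hW, hF])
    obtain ⟨μ, hμ⟩ := Module.End.exists_eigenvalue (Q.symm.toLinearMap ∘ₗ p)
    obtain ⟨w, hw, hw0⟩ := hμ.exists_hasEigenvector
    have e : p w = μ • q w := by
      have := congrArg Q (Module.End.mem_eigenspace_iff.1 hw)
      rw [map_smul] at this
      simp only [LinearMap.comp_apply, LinearEquiv.coe_coe, Q.apply_symm_apply] at this
      exact this
    exact ⟨w, μ • x + y, q w,
      by rw [key, e]; simp [TensorProduct.add_tmul, TensorProduct.smul_tmul'], hw0⟩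
  · rw [← LinearMap.ker_eq_bot, Submodule.eq_bot_iff] at hq
    push Not at hq
    obtain ⟨w, hw, hw0⟩ := hq
    exact ⟨w, x, p w, by rw [key, LinearMap.mem_ker.1 hw]; simp, hw0⟩

/-- Normal forms of two-dimensional spaces of tensors in `E ⊗ F`, `dim E = dim F = 2`. -/
theorem pencil_normal_form (hE : Module.finrank ℂ E = 2) (hF : Module.finrank ℂ F = 2)
    (hW : Module.finrank ℂ W = 2) {f : W →ₗ[ℂ] E ⊗[ℂ] F} (hf : Function.Injective f) :
    ∃ (a c : E) (b d : F), LinearIndependent ℂ ![a, c] ∧ LinearIndependent ℂ ![b, d] ∧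
      ((∀ u, ∃ α γ : ℂ, f u = α • a ⊗ₜ[ℂ] b + γ • c ⊗ₜ[ℂ] d) ∨
       (∀ u, ∃ α γ : ℂ, f u = α • a ⊗ₜ[ℂ] b + γ • (a ⊗ₜ[ℂ] d + c ⊗ₜ[ℂ] b)) ∨
       (∀ u, ∃ α γ : ℂ, f u = α • a ⊗ₜ[ℂ] b + γ • a ⊗ₜ[ℂ] d) ∨
       (∀ u, ∃ α γ : ℂ, f u = α • a ⊗ₜ[ℂ] b + γ • c ⊗ₜ[ℂ] b)) := by
  obtain ⟨w, a, b, e, hw, ha, hb⟩ := exists_ne_zero_map_eq_tmul hE hF hW hf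
  obtain ⟨w', hww⟩ := exists_pair_extending hW hw
  obtain ⟨c, hac⟩ := exists_pair_extending hE ha
  obtain ⟨d, hbd⟩ := exists_pair_extending hF hb
  obtain ⟨g, g', e'⟩ := exists_tmul_add_tmul hE hac (f w')
  obtain ⟨p, q, rfl⟩ := exists_pair_coords hF hbd g
  obtain ⟨r, s, rfl⟩ := exists_pair_coords hF hbd g'
  have hspan : ∀ u, ∃ α γ : ℂ, f u = α • a ⊗ₜ[ℂ] b +
      γ • (a ⊗ₜ[ℂ] (p • b + q • d) + c ⊗ₜ[ℂ] (r • b + s • d)) := by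
    intro u
    obtain ⟨α, γ, rfl⟩ := exists_pair_coords hW hww u
    exact ⟨α, γ, by simp only [map_add, map_smul, e, e']⟩
  have hac' := LinearIndependent.pair_iff.1 hac
  have hbd' := LinearIndependent.pair_iff.1 hbd
  by_cases hs : s = 0
  · subst hs
    by_cases hq : q = 0
    · refine ⟨a, c, b, d, hac, hbd, .inr <| .inr <| .inr fun u => ?_⟩
      obtain ⟨α, γ, e⟩ := hspan u
      refine ⟨α + γ * p, γ * r, ?_⟩
      rw [e, hq]; simp; module
    · by_cases hr : r = 0
      · refine ⟨a, c, b, d, hac, hbd, .inr <| .inr <| .inl fun u => ?_⟩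
        obtain ⟨α, γ, e⟩ := hspan u
        refine ⟨α + γ * p, γ * q, ?_⟩
        rw [e, hr]; simp [TensorProduct.tmul_add]; module
      · refine ⟨a, r • c, b, q • d, ?_, ?_, .inr <| .inl fun u => ?_⟩
        · rw [LinearIndependent.pair_iff]
          intro s t h
          have := hac' s (t * r) (by rw [← h, mul_smul])
          exact ⟨this.1, by simpa [hr] using this.2⟩
        · rw [LinearIndependent.pair_iff]
          intro s t h
          have := hbd' s (t * q) (by rw [← h, mul_smul])
          exact ⟨this.1, by simpa [hq] using this.2⟩
        · obtain ⟨α, γ, e⟩ := hspan u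
          refine ⟨α + γ * p, γ, ?_⟩
          rw [e]; simp [TensorProduct.tmul_add, ← TensorProduct.smul_tmul']; module
  -- When `s ≠ 0` the second tensor is a product modulo `a ⊗ b`: `q a ⊗ d + r c ⊗ b + s c ⊗ d = (s c
  -- + q a) ⊗ (d + (r / s) b) - (q r / s) a ⊗ b`.
  · refine ⟨a, s • c + q • a, b, d + (r / s) • b, ?_, ?_, .inl fun u => ?_⟩
    · rw [LinearIndependent.pair_iff]
      intro m t h
      have := hac' (m + t * q) (t * s) (by rw [← h]; module)
      have ht : t = 0 := by simpa [hs] using this.2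
      exact ⟨by simpa [ht] using this.1, ht⟩
    · rw [LinearIndependent.pair_iff]
      intro m t h
      have := hbd' (m + t * (r / s)) t (by rw [← h]; module)
      exact ⟨by simpa [this.2] using this.1, this.2⟩
    · obtain ⟨α, γ, e⟩ := hspan u
      refine ⟨α + γ * (p - q * (r / s)), γ, ?_⟩
      rw [e]
      simp only [TensorProduct.tmul_add, TensorProduct.add_tmul, TensorProduct.tmul_smul,
        ← TensorProduct.smul_tmul']
      match_scalars <;> field_simp
      ring

end LinearAlgebra

/-- The tensor `p y ⊗ x' + q x ⊗ y' + k y ⊗ y'`. -/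
def mixedTensor {E F : Type*} [AddCommGroup E] [Module ℂ E] [AddCommGroup F] [Module ℂ F]
    (p q k : ℂ) (x y : E) (x' y' : F) : E ⊗[ℂ] F :=
  p • y ⊗ₜ[ℂ] x' + q • x ⊗ₜ[ℂ] y' + k • y ⊗ₜ[ℂ] y'

/-- The triples `(p, q, k)` which occur in the normal forms. -/
def IsNormalCoeff (p q k : ℂ) : Prop :=
  (p = 0 ∧ q = 0 ∧ k = 1) ∨ (p = 1 ∧ k = 0) ∨ (p = 0 ∧ q = 1 ∧ k = 0)

section Independence

variable {E F : Type*} [AddCommGroup E] [Module ℂ E] [AddCommGroup F] [Module ℂ F]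

theorem linearIndependent_tmul_self_mixedTensor (hE : Module.finrank ℂ E = 2) {p q k : ℂ}
    (hc : IsNormalCoeff p q k) {x y : E} {x' y' : F}
    (h : LinearIndependent ℂ ![x, y]) (h' : LinearIndependent ℂ ![x', y']) :
    LinearIndependent ℂ ![x ⊗ₜ[ℂ] x', mixedTensor p q k x y x' y'] := by
  rw [LinearIndependent.pair_iff]
  intro s t e
  have := tensor_coords_inj hE h h' (a := s) (b := t * q) (c := t * p) (d := t * k)
    (a' := 0) (b' := 0) (c' := 0) (d' := 0) (by
      rw [mixedTensor] at e; simp only [zero_smul, add_zero]; rw [← e]; module)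
  obtain ⟨⟨h1, h2⟩, h3, h4⟩ := this
  refine ⟨h1, ?_⟩
  rcases hc with ⟨-, -, rfl⟩ | ⟨rfl, -⟩ | ⟨-, rfl, -⟩
  · simpa using h4
  · simpa using h3
  · simpa using h2

theorem linearIndependent_tmul_swap (hE : Module.finrank ℂ E = 2) {x y : E} {x' y' : F}
    (h : LinearIndependent ℂ ![x, y]) (h' : LinearIndependent ℂ ![x', y']) :
    LinearIndependent ℂ ![x ⊗ₜ[ℂ] y', y ⊗ₜ[ℂ] x'] := by
  rw [LinearIndependent.pair_iff]
  intro s t e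
  have := tensor_coords_inj hE h h' (a := 0) (b := s) (c := t) (d := 0)
    (a' := 0) (b' := 0) (c' := 0) (d' := 0) (by
      simp only [zero_smul, add_zero, zero_add]; rw [← e])
  exact ⟨this.1.2, this.2.1⟩

end Independence

/-! ### Consequences of associativity for the ranges of `β` -/

namespace SubproductSystem

variable {T : Type*} [AddSemigroup T] (A : SubproductSystem T)

theorem comult_injective (s t : T) {p : T} (h : s + t = p) :
    Function.Injective (A.β s t h).toLinearMap :=
  (A.β s t h).injective

/-- One step of the recursion constructing vectors `x_{n + 1}`, `y_{n + 1}` from the previous two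
pairs. -/
theorem exists_next_normal_pair {r d m n l : T} (hd : r + r = d) (hn : r + m = n) (hl : r + n = l)
    (hl' : d + m = l) {p q k : ℂ} (hc : IsNormalCoeff p q k) {x y : A.E r} {xd yd : A.E d}
    {xm ym : A.E m} {xn yn : A.E n} (h1 : LinearIndependent ℂ ![x, y])
    (hm : LinearIndependent ℂ ![xm, ym])
    (bxd : A.β r r hd xd = x ⊗ₜ[ℂ] x) (byd : A.β r r hd yd = mixedTensor p q k x y x y)
    (bxn : A.β r m hn xn = x ⊗ₜ[ℂ] xm) (byn : A.β r m hn yn = mixedTensor p q k x y xm ym) :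
    ∃ xl yl : A.E l, A.β r n hl xl = x ⊗ₜ[ℂ] xn ∧
      A.β r n hl yl = mixedTensor p q k x y xn yn := by
  have ind_d : LinearIndependent ℂ ![xd, yd] := by
    apply linearIndependent_pair_of_map (f := (A.β r r hd).toLinearMap)
    simpa [bxd, byd] using
      linearIndependent_tmul_self_mixedTensor (A.finrank_eq_two r) hc h1 h1
  have ind_n : LinearIndependent ℂ ![xn, yn] := by
    apply linearIndependent_pair_of_map (f := (A.β r m hn).toLinearMap)
    simpa [bxn, byn] using
      linearIndependent_tmul_self_mixedTensor (A.finrank_eq_two r) hc h1 hm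
  refine exists_preimages_of_range_le (A.finrank_eq_two l) (A.comult_injective r n hl) fun u => ?_
  -- Both splittings of `u` are expanded in bases, and associativity compares the eight coefficients
  -- in `E_r ⊗ E_r ⊗ E_m`.
  obtain ⟨f, g, e⟩ := exists_tmul_add_tmul (A.finrank_eq_two r) h1 (A.β r n hl u)
  obtain ⟨F, G, e'⟩ := exists_tmul_add_tmul (A.finrank_eq_two d) ind_d (A.β d m hl' u)
  obtain ⟨f1, f2, rfl⟩ := exists_pair_coords (A.finrank_eq_two n) ind_n f
  obtain ⟨g1, g2, rfl⟩ := exists_pair_coords (A.finrank_eq_two n) ind_n g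
  obtain ⟨F1, F2, rfl⟩ := exists_pair_coords (A.finrank_eq_two m) hm F
  obtain ⟨G1, G2, rfl⟩ := exists_pair_coords (A.finrank_eq_two m) hm G
  have as := A.assoc r r m hd hl' hn hl u
  rw [e, e'] at as
  simp only [map_add, TensorProduct.map_tmul, TensorProduct.tmul_add, TensorProduct.tmul_smul,
    map_smul, LinearIsometry.coe_toLinearMap, bxd, byd, bxn, byn, LinearMap.id_apply, mixedTensor,
    TensorProduct.add_tmul, ← TensorProduct.smul_tmul', TensorProduct.assoc_tmul] at as
  have := tmul_add_tmul_inj (A.finrank_eq_two r) h1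
    (f := F1 • x ⊗ₜ[ℂ] xm + F2 • x ⊗ₜ[ℂ] ym + (q * G1) • y ⊗ₜ[ℂ] xm + (q * G2) • y ⊗ₜ[ℂ] ym)
    (g := (p * G1) • x ⊗ₜ[ℂ] xm + (p * G2) • x ⊗ₜ[ℂ] ym
      + (k * G1) • y ⊗ₜ[ℂ] xm + (k * G2) • y ⊗ₜ[ℂ] ym)
    (f' := f1 • x ⊗ₜ[ℂ] xm + (f2 * q) • x ⊗ₜ[ℂ] ym + (f2 * p) • y ⊗ₜ[ℂ] xm
      + (f2 * k) • y ⊗ₜ[ℂ] ym)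
    (g' := g1 • x ⊗ₜ[ℂ] xm + (g2 * q) • x ⊗ₜ[ℂ] ym + (g2 * p) • y ⊗ₜ[ℂ] xm
      + (g2 * k) • y ⊗ₜ[ℂ] ym) (by
      simp only [TensorProduct.tmul_add, TensorProduct.tmul_smul]
      refine Eq.trans ?_ (as.trans ?_) <;> module)
  obtain ⟨⟨-, -⟩, i3, i4⟩ := tensor_coords_inj (A.finrank_eq_two r) h1 hm this.1
  obtain ⟨⟨i5, i6⟩, i7, i8⟩ := tensor_coords_inj (A.finrank_eq_two r) h1 hm this.2
  -- Membership in the span of the two targets means that `(g1, f2, g2)` is proportional to `(p, q,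
  -- k)`; each normal triple allows this to be extracted separately.
  suffices h : ∃ z, f2 = z * q ∧ g1 = z * p ∧ g2 = z * k by
    obtain ⟨z, z1, z2, z3⟩ := h
    refine ⟨f1, z, ?_⟩
    rw [LinearIsometry.coe_toLinearMap, e, z1, z2, z3, mixedTensor]
    simp only [TensorProduct.tmul_add, TensorProduct.tmul_smul]
    module
  rcases hc with ⟨rfl, rfl, rfl⟩ | ⟨rfl, rfl⟩ | ⟨rfl, rfl, rfl⟩
  · exact ⟨g2, by linear_combination -i4, by linear_combination -i5, by ring⟩
  · exact ⟨G1, by linear_combination -i3, by linear_combination -i5, by linear_combination -i7⟩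
  · exact ⟨f2, by ring, by linear_combination -i5, by linear_combination -i6⟩

/-- The recursion for the alternating plane, by the same comparison of coefficients. It serves only
to reach time 4, where a square appears. -/
theorem exists_next_alternating_pair {r d m n l : T} (hd : r + r = d) (hn : r + m = n)
    (hl : r + n = l) (hl' : d + m = l) {x y : A.E r} {xd yd : A.E d}
    {xm ym : A.E m} {xn yn : A.E n} (h1 : LinearIndependent ℂ ![x, y])
    (hm : LinearIndependent ℂ ![xm, ym])
    (bxd : A.β r r hd xd = x ⊗ₜ[ℂ] y) (byd : A.β r r hd yd = y ⊗ₜ[ℂ] x)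
    (bxn : A.β r m hn xn = x ⊗ₜ[ℂ] ym) (byn : A.β r m hn yn = y ⊗ₜ[ℂ] xm) :
    ∃ xl yl : A.E l, A.β r n hl xl = x ⊗ₜ[ℂ] yn ∧ A.β r n hl yl = y ⊗ₜ[ℂ] xn := by
  have ind_d : LinearIndependent ℂ ![xd, yd] := by
    apply linearIndependent_pair_of_map (f := (A.β r r hd).toLinearMap)
    simpa [bxd, byd] using linearIndependent_tmul_swap (A.finrank_eq_two r) h1 h1
  have ind_n : LinearIndependent ℂ ![xn, yn] := by
    apply linearIndependent_pair_of_map (f := (A.β r m hn).toLinearMap)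
    simpa [bxn, byn] using linearIndependent_tmul_swap (A.finrank_eq_two r) h1 hm
  refine exists_preimages_of_range_le (A.finrank_eq_two l) (A.comult_injective r n hl) fun u => ?_
  obtain ⟨f, g, e⟩ := exists_tmul_add_tmul (A.finrank_eq_two r) h1 (A.β r n hl u)
  obtain ⟨F, G, e'⟩ := exists_tmul_add_tmul (A.finrank_eq_two d) ind_d (A.β d m hl' u)
  obtain ⟨f1, f2, rfl⟩ := exists_pair_coords (A.finrank_eq_two n) ind_n f
  obtain ⟨g1, g2, rfl⟩ := exists_pair_coords (A.finrank_eq_two n) ind_n g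
  obtain ⟨F1, F2, rfl⟩ := exists_pair_coords (A.finrank_eq_two m) hm F
  obtain ⟨G1, G2, rfl⟩ := exists_pair_coords (A.finrank_eq_two m) hm G
  have as := A.assoc r r m hd hl' hn hl u
  rw [e, e'] at as
  simp only [map_add, TensorProduct.map_tmul, TensorProduct.tmul_add, TensorProduct.tmul_smul,
    map_smul, LinearIsometry.coe_toLinearMap, bxd, byd, bxn, byn, LinearMap.id_apply,
    TensorProduct.assoc_tmul] at as
  have := tmul_add_tmul_inj (A.finrank_eq_two r) h1
    (f := (0 : ℂ) • x ⊗ₜ[ℂ] xm + (0 : ℂ) • x ⊗ₜ[ℂ] ym + F1 • y ⊗ₜ[ℂ] xm + F2 • y ⊗ₜ[ℂ] ym)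
    (g := G1 • x ⊗ₜ[ℂ] xm + G2 • x ⊗ₜ[ℂ] ym + (0 : ℂ) • y ⊗ₜ[ℂ] xm + (0 : ℂ) • y ⊗ₜ[ℂ] ym)
    (f' := (0 : ℂ) • x ⊗ₜ[ℂ] xm + f1 • x ⊗ₜ[ℂ] ym + f2 • y ⊗ₜ[ℂ] xm + (0 : ℂ) • y ⊗ₜ[ℂ] ym)
    (g' := (0 : ℂ) • x ⊗ₜ[ℂ] xm + g1 • x ⊗ₜ[ℂ] ym + g2 • y ⊗ₜ[ℂ] xm + (0 : ℂ) • y ⊗ₜ[ℂ] ym) (by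
      simp only [TensorProduct.tmul_add, TensorProduct.tmul_smul]
      refine Eq.trans ?_ (as.trans ?_) <;> module)
  obtain ⟨⟨-, i1⟩, -, -⟩ := tensor_coords_inj (A.finrank_eq_two r) h1 hm this.1
  obtain ⟨-, i2, -⟩ := tensor_coords_inj (A.finrank_eq_two r) h1 hm this.2
  refine ⟨f2, g1, ?_⟩
  rw [LinearIsometry.coe_toLinearMap, e, ← i1, ← i2]
  simp

/-- If the range of `β_{r,r}` is spanned by `a ⊗ b` and `c ⊗ d'`, then `b` is proportional to `a` or
to `c`. -/
theorem factor_of_two_products {r d e : T} (hd : r + r = d) (he : d + r = e) (he' : r + d = e)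
    {a c b d' : A.E r} (hac : LinearIndependent ℂ ![a, c]) (hbd : LinearIndependent ℂ ![b, d'])
    (H : ∀ u, ∃ α γ : ℂ, A.β r r hd u = α • a ⊗ₜ[ℂ] b + γ • c ⊗ₜ[ℂ] d') :
    (∃ μ : ℂ, b = μ • a) ∨ ∃ μ : ℂ, b = μ • c := by
  have h2 := A.finrank_eq_two r
  have hbd' := LinearIndependent.pair_iff.1 hbd
  obtain ⟨b1, b2, hb⟩ := exists_pair_coords h2 hac b
  obtain ⟨d1, d2, hdd⟩ := exists_pair_coords h2 hac d'
  by_contra! hcon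
  have hb1 : b1 ≠ 0 := by rintro rfl; exact hcon.2 b2 (by simpa using hb)
  have hb2 : b2 ≠ 0 := by rintro rfl; exact hcon.1 b1 (by simpa using hb)
  have hd12 : d1 ≠ 0 ∨ d2 ≠ 0 := by
    by_contra! h
    exact hbd.ne_zero 1 (by simpa [h.1, h.2] using hdd)
  obtain ⟨xd, yd, bxd, byd⟩ := exists_preimages_of_range_le (A.finrank_eq_two d)
    (A.comult_injective r r hd) H
  rw [LinearIsometry.coe_toLinearMap] at bxd byd
  have ind_d : LinearIndependent ℂ ![xd, yd] := by
    apply linearIndependent_pair_of_map (f := (A.β r r hd).toLinearMap)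
    simpa [bxd, byd] using linearIndependent_tmul_swap h2 hac
      (LinearIndependent.pair_symm_iff.1 hbd)
  -- With `β_{d,r} u = xd ⊗ P + yd ⊗ Q`, associativity puts `b ⊗ P` and `d' ⊗ Q` in the range of
  -- `β_{r,r}`. If `b` has both coordinates nonzero, `P` is proportional to both `b` and `d'`, so it
  -- vanishes; `Q` is then confined to a line, too small for the injective `β_{d,r}`.
  have main : ∀ u, ∃ Q : A.E r, A.β d r he u = yd ⊗ₜ[ℂ] Q ∧
      ∃ α γ : ℂ, d1 • Q = α • b ∧ d2 • Q = γ • d' := by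
    intro u
    obtain ⟨f, g, e⟩ := exists_tmul_add_tmul h2 hac (A.β r d he' u)
    obtain ⟨P, Q, e'⟩ := exists_tmul_add_tmul (A.finrank_eq_two d) ind_d (A.β d r he u)
    have as := A.assoc r r r hd he hd he' u
    rw [e, e'] at as
    simp only [map_add, TensorProduct.map_tmul, LinearIsometry.coe_toLinearMap, bxd, byd,
      LinearMap.id_apply, TensorProduct.assoc_tmul] at as
    obtain ⟨i1, i2⟩ := tmul_add_tmul_inj h2 hac as
    obtain ⟨α, γ, h⟩ := H f
    obtain ⟨α', γ', h'⟩ := H g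
    have hP := tmul_add_tmul_inj h2 hac (f := b1 • P) (g := b2 • P) (f' := α • b)
      (g' := γ • d') (by
        rw [TensorProduct.tmul_smul, TensorProduct.tmul_smul, TensorProduct.smul_tmul',
          TensorProduct.smul_tmul', ← TensorProduct.add_tmul, ← hb, i1, h]
        simp only [TensorProduct.tmul_smul])
    have hQ := tmul_add_tmul_inj h2 hac (f := d1 • Q) (g := d2 • Q) (f' := α' • b)
      (g' := γ' • d') (by
        rw [TensorProduct.tmul_smul, TensorProduct.tmul_smul, TensorProduct.smul_tmul',
          TensorProduct.smul_tmul', ← TensorProduct.add_tmul, ← hdd, i2, h']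
        simp only [TensorProduct.tmul_smul])
    have hP0 : P = 0 := by
      have hP1 : P = (b1⁻¹ * α) • b := by rw [mul_smul, ← hP.1, inv_smul_smul₀ hb1]
      have hP2 : P = (b2⁻¹ * γ) • d' := by rw [mul_smul, ← hP.2, inv_smul_smul₀ hb2]
      have := hbd' (b1⁻¹ * α) (-(b2⁻¹ * γ)) (by rw [neg_smul, ← hP1, ← hP2]; simp)
      rw [hP1, this.1, zero_smul]
    exact ⟨Q, by rw [e', hP0]; simp, α', γ', hQ⟩
  rcases hd12 with hd1 | hd2
  · refine not_range_le_line (A.finrank_eq_two e) (A.comult_injective d r he) (yd ⊗ₜ[ℂ] b)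
      fun u => ?_
    obtain ⟨Q, e, α, γ, h, -⟩ := main u
    refine ⟨d1⁻¹ * α, ?_⟩
    rw [LinearIsometry.coe_toLinearMap, e, ← TensorProduct.tmul_smul, mul_smul, ← h,
      inv_smul_smul₀ hd1]
  · refine not_range_le_line (A.finrank_eq_two e) (A.comult_injective d r he) (yd ⊗ₜ[ℂ] d')
      fun u => ?_
    obtain ⟨Q, e, α, γ, -, h⟩ := main u
    refine ⟨d2⁻¹ * γ, ?_⟩
    rw [LinearIsometry.coe_toLinearMap, e, ← TensorProduct.tmul_smul, mul_smul, ← h,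
      inv_smul_smul₀ hd2]

/-- If the range of `β_{r,r}` is spanned by `a ⊗ b` and `a ⊗ d' + c ⊗ b`, then `b` is proportional
to `a`. -/
theorem factor_of_tangent {r d e : T} (hd : r + r = d) (he : d + r = e) (he' : r + d = e)
    {a c b d' : A.E r} (hac : LinearIndependent ℂ ![a, c]) (hbd : LinearIndependent ℂ ![b, d'])
    (H : ∀ u, ∃ α γ : ℂ, A.β r r hd u = α • a ⊗ₜ[ℂ] b + γ • (a ⊗ₜ[ℂ] d' + c ⊗ₜ[ℂ] b)) :
    ∃ μ : ℂ, b = μ • a := by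
  have h2 := A.finrank_eq_two r
  have hbd' := LinearIndependent.pair_iff.1 hbd
  obtain ⟨b1, b2, hb⟩ := exists_pair_coords h2 hac b
  by_contra! hcon
  have hb2 : b2 ≠ 0 := by rintro rfl; exact hcon b1 (by simpa using hb)
  obtain ⟨xd, yd, bxd, byd⟩ := exists_preimages_of_range_le (A.finrank_eq_two d)
    (A.comult_injective r r hd) H
  rw [LinearIsometry.coe_toLinearMap] at bxd byd
  have ind_d : LinearIndependent ℂ ![xd, yd] := by
    apply linearIndependent_pair_of_map (f := (A.β r r hd).toLinearMap)
    rw [LinearIsometry.coe_toLinearMap, bxd, byd, LinearIndependent.pair_iff]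
    intro s t h
    have := tensor_coords_inj h2 hac hbd (a := s) (b := t) (c := t) (d := 0)
      (a' := 0) (b' := 0) (c' := 0) (d' := 0) (by
        simp only [zero_smul, add_zero]; rw [← h]; module)
    exact ⟨this.1.1, this.2.1⟩
  -- The `c`-component makes `P` a multiple of `b`; the `a`-component then kills the tangent
  -- coefficient. Applied to `Q` and then to `P`, this would make `β_{d,r}` vanish.
  have kill : ∀ (P : A.E r) (f : A.E d), b ⊗ₜ[ℂ] P = A.β r r hd f → P = 0 := by
    intro P f h
    obtain ⟨α, γ, e⟩ := H f
    rw [e] at h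
    have := tmul_add_tmul_inj h2 hac (f := b1 • P) (g := b2 • P) (f' := α • b + γ • d')
      (g' := γ • b) (by
        rw [TensorProduct.tmul_smul, TensorProduct.tmul_smul, TensorProduct.smul_tmul',
          TensorProduct.smul_tmul', ← TensorProduct.add_tmul, ← hb, h]
        simp only [TensorProduct.tmul_add, TensorProduct.tmul_smul]
        module)
    have hP : P = (b2⁻¹ * γ) • b := by rw [mul_smul, ← this.2, inv_smul_smul₀ hb2]
    have h0 := hbd' (b1 * (b2⁻¹ * γ) - α) (-γ) (by
      have h1 := this.1
      rw [hP] at h1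
      rw [sub_smul, mul_smul, h1]; module)
    rw [hP, neg_eq_zero.1 h0.2]; simp
  have : Nontrivial (A.E e) :=
    Module.nontrivial_of_finrank_pos (R := ℂ) (by rw [A.finrank_eq_two]; norm_num)
  obtain ⟨u, hu⟩ := exists_ne (0 : A.E e)
  obtain ⟨f, g, e⟩ := exists_tmul_add_tmul h2 hac (A.β r d he' u)
  obtain ⟨P, Q, e'⟩ := exists_tmul_add_tmul (A.finrank_eq_two d) ind_d (A.β d r he u)
  have as := A.assoc r r r hd he hd he' u
  rw [e, e'] at as
  simp only [map_add, TensorProduct.map_tmul, LinearIsometry.coe_toLinearMap, bxd, byd,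
    LinearMap.id_apply, TensorProduct.assoc_tmul, TensorProduct.add_tmul] at as
  obtain ⟨i1, i2⟩ := tmul_add_tmul_inj h2 hac
    (f := b ⊗ₜ[ℂ] P + d' ⊗ₜ[ℂ] Q) (g := b ⊗ₜ[ℂ] Q) (by
      rw [← as, TensorProduct.tmul_add]; abel)
  have hQ := kill Q g i2
  have hP := kill P f (by rw [← i1, hQ]; simp)
  apply hu
  apply A.comult_injective d r he
  rw [LinearIsometry.coe_toLinearMap, e', hP, hQ]
  simp

/-- The range of `β_{r,r}`, up to the choice of a basis of `E_r`. -/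
theorem exists_basis_diagonal {r d e : T} (hd : r + r = d) (he : d + r = e) (he' : r + d = e) :
    ∃ x y : A.E r, LinearIndependent ℂ ![x, y] ∧
      ((∃ p q k, IsNormalCoeff p q k ∧
        ∀ u, ∃ α γ : ℂ, A.β r r hd u = α • x ⊗ₜ[ℂ] x + γ • mixedTensor p q k x y x y) ∨
      ∀ u, ∃ α γ : ℂ, A.β r r hd u = α • x ⊗ₜ[ℂ] y + γ • y ⊗ₜ[ℂ] x) := by
  have h2 := A.finrank_eq_two r
  obtain ⟨a, c, b, d', hac, hbd, H⟩ := pencil_normal_form h2 h2 (A.finrank_eq_two d)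
    (A.comult_injective r r hd)
  simp only [LinearIsometry.coe_toLinearMap] at H
  have hbd' := LinearIndependent.pair_iff.1 hbd
  have hb0 : b ≠ 0 := hbd.ne_zero 0
  obtain ⟨b1, b2, hb⟩ := exists_pair_coords h2 hac b
  obtain ⟨d1, d2, hdd⟩ := exists_pair_coords h2 hac d'
  rcases H with H | H | H | H
  · have H' : ∀ u, ∃ α γ : ℂ, A.β r r hd u = α • c ⊗ₜ[ℂ] d' + γ • a ⊗ₜ[ℂ] b := fun u => by
      obtain ⟨α, γ, e⟩ := H u
      exact ⟨γ, α, by rw [e, add_comm]⟩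
    have dep : ∀ (μ ν : ℂ) (z : A.E r), b = μ • z → d' = ν • z → False := by
      rintro μ ν z rfl rfl
      have := hbd' ν (-μ) (by module)
      exact hb0 (by rw [neg_eq_zero.1 this.2, zero_smul])
    -- By symmetry `d'` is also proportional to `a` or to `c`. Independence of `b, d'` leaves two
    -- squares or the alternating plane.
    rcases A.factor_of_two_products hd he he' hac hbd H with ⟨μ, h⟩ | ⟨μ, h⟩ <;>
    rcases A.factor_of_two_products hd he he' (LinearIndependent.pair_symm_iff.1 hac)
        (LinearIndependent.pair_symm_iff.1 hbd) H' with
      ⟨ν, h'⟩ | ⟨ν, h'⟩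
    · refine ⟨a, c, hac, .inl ⟨0, 0, 1, by simp [IsNormalCoeff], fun u => ?_⟩⟩
      obtain ⟨α, γ, e⟩ := H u
      refine ⟨α * μ, γ * ν, ?_⟩
      rw [e, h, h', mixedTensor]
      simp only [TensorProduct.tmul_smul]
      module
    · exact (dep μ ν a h h').elim
    · exact (dep μ ν c h h').elim
    · refine ⟨a, c, hac, .inr fun u => ?_⟩
      obtain ⟨α, γ, e⟩ := H u
      refine ⟨α * μ, γ * ν, ?_⟩
      rw [e, h, h']
      simp only [TensorProduct.tmul_smul]
      module
  · obtain ⟨μ, h⟩ := A.factor_of_tangent hd he he' hac hbd H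
    have hμ : μ ≠ 0 := by rintro rfl; exact hb0 (by simpa using h)
    refine ⟨a, c, hac, .inl ⟨1, d2 / μ, 0, by simp [IsNormalCoeff], fun u => ?_⟩⟩
    obtain ⟨α, γ, e⟩ := H u
    refine ⟨α * μ + γ * d1, γ * μ, ?_⟩
    rw [e, h, hdd, mixedTensor]
    simp only [TensorProduct.tmul_add, TensorProduct.tmul_smul]
    match_scalars <;> field_simp
    ring
  · refine ⟨a, c, hac, .inl ⟨0, 1, 0, by simp [IsNormalCoeff], fun u => ?_⟩⟩
    obtain ⟨α, γ, e⟩ := H u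
    refine ⟨α * b1 + γ * d1, α * b2 + γ * d2, ?_⟩
    rw [e, hb, hdd, mixedTensor]
    simp only [TensorProduct.tmul_add, TensorProduct.tmul_smul]
    module
  · refine ⟨b, d', hbd, .inl ⟨1, 0, 0, by simp [IsNormalCoeff], fun u => ?_⟩⟩
    obtain ⟨α, γ, e⟩ := H u
    obtain ⟨a1, a2, ha⟩ := exists_pair_coords h2 hbd a
    obtain ⟨c1, c2, hc⟩ := exists_pair_coords h2 hbd c
    refine ⟨α * a1 + γ * c1, α * a2 + γ * c2, ?_⟩
    rw [e, ha, hc, mixedTensor]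
    simp only [TensorProduct.add_tmul, ← TensorProduct.smul_tmul']
    module

end SubproductSystem

/-! ### Unit bases adapted to the range of `β_{r,r}` -/

section Normalization

variable {E : Type*} [NormedAddCommGroup E] [InnerProductSpace ℂ E]

theorem norm_inner_lt_one {x y : E} (hx : ‖x‖ = 1) (hy : ‖y‖ = 1)
    (h : LinearIndependent ℂ ![x, y]) : ‖inner ℂ x y‖ < 1 := by
  have hle : ‖inner ℂ x y‖ ≤ 1 := by simpa [hx, hy] using norm_inner_le_norm (𝕜 := ℂ) x y
  refine lt_of_le_of_ne hle fun e => ?_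
  have := (norm_inner_eq_norm_iff (𝕜 := ℂ) (h.ne_zero 0) (h.ne_zero 1)).1
    (by simpa [hx, hy] using e)
  obtain ⟨r, -, hr⟩ := this
  have hr : y = r • x := hr
  have := (LinearIndependent.pair_iff.1 h r (-1) (by rw [hr]; simp)).2
  norm_num at this

theorem linearIndependent_of_norm_inner_lt_one {x y : E} (hx : ‖x‖ = 1) (hy : ‖y‖ = 1)
    (h : ‖inner ℂ x y‖ < 1) : LinearIndependent ℂ ![x, y] := by
  have hx0 : x ≠ 0 := by rintro rfl; simp at hx
  rw [LinearIndependent.pair_iff' hx0]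
  rintro a rfl
  have ha : ‖a‖ = 1 := by simpa [norm_smul, hx] using hy
  rw [inner_smul_right, norm_mul, ha, inner_self_eq_norm_sq_to_K, hx] at h
  simp at h

theorem exists_normalized_of_ne_zero {x : E} (hx : x ≠ 0) :
    ∃ x' : E, ‖x'‖ = 1 ∧ ∃ u : ℂ, u ≠ 0 ∧ x = u • x' := by
  have hn : (‖x‖ : ℂ) ≠ 0 := by simpa using hx
  refine ⟨(‖x‖ : ℂ)⁻¹ • x, ?_, (‖x‖ : ℂ), hn, by rw [smul_inv_smul₀ hn]⟩
  rw [norm_smul, norm_inv, Complex.norm_real, norm_norm, inv_mul_cancel₀ (by simpa using hx)]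

theorem exists_normalized_pair {x y : E} (h : LinearIndependent ℂ ![x, y]) :
    ∃ x' y' : E, ∃ a : ℝ, ‖x'‖ = 1 ∧ ‖y'‖ = 1 ∧ 0 ≤ a ∧ a < 1 ∧ inner ℂ x' y' = (a : ℂ) ∧
      ∃ u v : ℂ, x = u • x' ∧ y = v • y' := by
  obtain ⟨x', hx', u, hu, ex⟩ := exists_normalized_of_ne_zero (h.ne_zero 0)
  obtain ⟨y', hy', v, hv, ey⟩ := exists_normalized_of_ne_zero (h.ne_zero 1)
  have ex : x = u • x' := ex
  have ey : y = v • y' := ey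
  obtain ⟨c, hc, e⟩ := RCLike.exists_norm_eq_mul_self (inner ℂ x' y')
  have hc0 : c ≠ 0 := by rintro rfl; simp at hc
  refine ⟨x', c • y', ‖inner ℂ x' y'‖, hx', by rw [norm_smul, hc, hy', one_mul], norm_nonneg _,
    norm_inner_lt_one hx' hy' ?_, by rw [inner_smul_right]; exact e.symm, u, v * c⁻¹, ex, ?_⟩
  · have := LinearIndependent.pair_iff.1 h
    rw [LinearIndependent.pair_iff]
    intro s t e
    have := this (s * u⁻¹) (t * v⁻¹) (by
      rw [ex, ey, mul_smul, mul_smul, inv_smul_smul₀ hu, inv_smul_smul₀ hv, e])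
    exact ⟨by simpa [hu] using this.1, by simpa [hv] using this.2⟩
  · rw [mul_smul, inv_smul_smul₀ hc0, ey]

theorem exists_orthogonal_unit (hE : Module.finrank ℂ E = 2) {x : E} (hx : ‖x‖ = 1) :
    ∃ y : E, ‖y‖ = 1 ∧ inner ℂ x y = 0 := by
  have hx0 : x ≠ 0 := by rintro rfl; simp at hx
  obtain ⟨y, h⟩ := exists_pair_extending hE hx0
  have h0 : y - inner ℂ x y • x ≠ 0 := by
    intro e
    have := (LinearIndependent.pair_iff.1 h (-inner ℂ x y) 1 (by rw [← e]; module)).2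
    norm_num at this
  obtain ⟨z, hz, v, hv, e⟩ := exists_normalized_of_ne_zero h0
  refine ⟨z, hz, ?_⟩
  have h1 : inner ℂ x (y - inner ℂ x y • x) = 0 := by
    rw [inner_sub_right, inner_smul_right, inner_self_eq_norm_sq_to_K, hx]; simp
  rw [e, inner_smul_right] at h1
  exact (mul_eq_zero.1 h1).resolve_left hv

end Normalization

namespace SubproductSystem

/-- If `k = 0`, adding a multiple of `x` to `y` changes the mixed tensor only by a multiple of `x ⊗
x`, so `y` may be taken orthogonal to `x`. If `k = 1`, only rescaling is free: a phase makes the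
inner product nonnegative, but its modulus `a` remains. -/
theorem exists_normalized_basis_diagonal {T : Type*} [AddSemigroup T] (A : SubproductSystem T)
    {r d e : T} (hd : r + r = d) (he : d + r = e) (he' : r + d = e) :
    (∃ x y : A.E r, ∃ p q k : ℂ, ∃ a : ℝ, ‖x‖ = 1 ∧ ‖y‖ = 1 ∧ 0 ≤ a ∧ a < 1 ∧
      inner ℂ x y = (a : ℂ) ∧ IsNormalCoeff p q k ∧ (k = 0 → a = 0) ∧
      ∀ u, ∃ α γ : ℂ, A.β r r hd u = α • x ⊗ₜ[ℂ] x + γ • mixedTensor p q k x y x y) ∨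
    ∃ x y : A.E r, LinearIndependent ℂ ![x, y] ∧
      ∀ u, ∃ α γ : ℂ, A.β r r hd u = α • x ⊗ₜ[ℂ] y + γ • y ⊗ₜ[ℂ] x := by
  obtain ⟨x, y, h, ⟨p, q, k, hc, H⟩ | H⟩ := A.exists_basis_diagonal hd he he'
  · left
    by_cases hk : k = 0
    · subst hk
      obtain ⟨x', hx', u, -, ex⟩ := exists_normalized_of_ne_zero (h.ne_zero 0)
      have ex : x = u • x' := ex
      obtain ⟨y', hy', hxy⟩ := exists_orthogonal_unit (A.finrank_eq_two r) hx'
      refine ⟨x', y', p, q, 0, 0, hx', hy', le_rfl, one_pos, by simpa using hxy, hc,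
        fun _ => rfl, fun w => ?_⟩
      obtain ⟨m, n, ey⟩ := exists_pair_coords (A.finrank_eq_two r)
        (linearIndependent_of_norm_inner_lt_one hx' hy' (by simp [hxy])) y
      obtain ⟨α, γ, e⟩ := H w
      refine ⟨α * u ^ 2 + γ * (u * m * (p + q)), γ * (u * n), ?_⟩
      rw [e, ex, ey]
      simp only [mixedTensor, TensorProduct.tmul_add, TensorProduct.add_tmul,
        TensorProduct.tmul_smul, ← TensorProduct.smul_tmul']
      module
    · obtain ⟨rfl, rfl, rfl⟩ : p = 0 ∧ q = 0 ∧ k = 1 := by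
        rcases hc with hc | hc | hc
        · exact hc
        · exact absurd hc.2 hk
        · exact absurd hc.2.2 hk
      obtain ⟨x', y', a, hx', hy', ha, ha', hxy, u, v, ex, ey⟩ := exists_normalized_pair h
      refine ⟨x', y', 0, 0, 1, a, hx', hy', ha, ha', hxy, hc, by simp, fun w => ?_⟩
      obtain ⟨α, γ, e⟩ := H w
      refine ⟨α * u ^ 2, γ * v ^ 2, ?_⟩
      rw [e, ex, ey]
      simp only [mixedTensor, TensorProduct.tmul_smul, ← TensorProduct.smul_tmul']
      module
  · exact .inr ⟨x, y, h, H⟩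

end SubproductSystem

theorem PNat.exists_dependent_seq {S : ℕ+ → Type*} (R : ∀ n, S n → S (n + 1) → Prop) (s : S 1)
    (h : ∀ n (a : S n), ∃ b, R n a b) : ∃ f : ∀ n, S n, f 1 = s ∧ ∀ n, R n (f n) (f (n + 1)) := by
  choose g hg using h
  refine ⟨fun n => PNat.recOn n s g, by simp, fun n => ?_⟩
  simp only [PNat.recOn_succ]
  exact hg _ _

/-! ### Discrete time: vectors generated from time 1 -/

namespace DiscreteSubproductSystem

variable (A : SubproductSystem ℕ+)

/-- The vectors `x`, `y` multiply by the rule with coefficients `p`, `q`, `k`. -/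
def Multiplies (p q k : ℂ) (x y : ∀ n, A.E n) : Prop :=
  ∀ s t : ℕ+, A.β s t rfl (x (s + t)) = x s ⊗ₜ[ℂ] x t ∧
    A.β s t rfl (y (s + t)) = mixedTensor p (q ^ (s : ℕ)) k (x s) (y s) (x t) (y t)

theorem exists_multiplies {p q k : ℂ} (hc : IsNormalCoeff p q k) {x y : A.E 1}
    (h : LinearIndependent ℂ ![x, y])
    (H : ∀ u, ∃ α γ : ℂ, A.β 1 1 rfl u = α • x ⊗ₜ[ℂ] x + γ • mixedTensor p q k x y x y) :
    ∃ X Y : ∀ n, A.E n, X 1 = x ∧ Y 1 = y ∧ Multiplies A p q k X Y := by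
  obtain ⟨xd, yd, bxd, byd⟩ := exists_preimages_of_range_le (A.finrank_eq_two (1 + 1))
    (A.comult_injective 1 1 rfl) H
  rw [LinearIsometry.coe_toLinearMap] at bxd byd
  -- The recursion needs two consecutive pairs, so the state at `n` carries the pairs at times `n`
  -- and `n + 1`.
  let S : ℕ+ → Type _ := fun n =>
    {w : (A.E n × A.E n) × (A.E (n + 1) × A.E (n + 1)) // LinearIndependent ℂ ![w.1.1, w.1.2] ∧
      A.β 1 n (add_comm 1 n) w.2.1 = x ⊗ₜ[ℂ] w.1.1 ∧
      A.β 1 n (add_comm 1 n) w.2.2 = mixedTensor p q k x y w.1.1 w.1.2}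
  obtain ⟨f, f1, hf⟩ := PNat.exists_dependent_seq (S := S) (fun n a b => b.1.1 = a.1.2)
    ⟨((x, y), (xd, yd)), h, bxd, byd⟩ (by
      rintro n ⟨⟨⟨xm, ym⟩, ⟨xn, yn⟩⟩, hm, bxn, byn⟩
      obtain ⟨xl, yl, bxl, byl⟩ := A.exists_next_normal_pair (r := 1) (d := 1 + 1) (m := n)
        (n := n + 1) (l := n + 1 + 1) rfl (add_comm 1 n)
        (add_comm 1 (n + 1)) (by rw [add_comm, add_assoc]) hc h hm bxd byd bxn byn
      refine ⟨⟨((xn, yn), (xl, yl)), ?_, bxl, byl⟩, rfl⟩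
      apply linearIndependent_pair_of_map (f := (A.β 1 n (add_comm 1 n)).toLinearMap)
      simp only [LinearIsometry.coe_toLinearMap] at bxn byn ⊢
      rw [bxn, byn]
      exact linearIndependent_tmul_self_mixedTensor (A.finrank_eq_two 1) hc h hm)
  have fX : ∀ n, (f (n + 1)).1.1.1 = (f n).1.2.1 := fun n => congrArg Prod.fst (hf n)
  have fY : ∀ n, (f (n + 1)).1.1.2 = (f n).1.2.2 := fun n => congrArg Prod.snd (hf n)
  have X1 : (f 1).1.1.1 = x := by rw [f1]
  have Y1 : (f 1).1.1.2 = y := by rw [f1]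
  -- This and `p * p = p` are all that the induction on `s` needs from the normal triples.
  have hk : ∀ n : ℕ+, k * q ^ (n : ℕ) = k * p := by
    intro n
    rcases hc with ⟨rfl, rfl, rfl⟩ | ⟨rfl, rfl⟩ | ⟨rfl, rfl, rfl⟩ <;> simp
  have hp : p * p = p := by
    rcases hc with ⟨rfl, -⟩ | ⟨rfl, -⟩ | ⟨rfl, -⟩ <;> simp
  refine ⟨fun n => (f n).1.1.1, fun n => (f n).1.1.2, X1, Y1, ?_⟩
  suffices key : ∀ s t u (e : s + t = u), A.β s t e (f u).1.1.1 = (f s).1.1.1 ⊗ₜ[ℂ] (f t).1.1.1 ∧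
      A.β s t e (f u).1.1.2 =
        mixedTensor p (q ^ (s : ℕ)) k (f s).1.1.1 (f s).1.1.2 (f t).1.1.1 (f t).1.1.2 from
    fun s t => key s t _ rfl
  have base : ∀ t u (e : 1 + t = u), A.β 1 t e (f u).1.1.1 = x ⊗ₜ[ℂ] (f t).1.1.1 ∧
      A.β 1 t e (f u).1.1.2 = mixedTensor p q k x y (f t).1.1.1 (f t).1.1.2 := by
    intro t u e
    obtain rfl : u = t + 1 := by rw [← e, add_comm]
    rw [fX, fY]
    exact (f t).2.2
  intro s
  induction s with
  | one =>
    intro t u e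
    rw [X1, Y1]
    simpa using base t u e
  | succ s ih =>
    intro t u e
    have e' : 1 + (s + t) = u := by rw [← e, ← add_assoc, add_comm 1 s]
    -- Identities in `E_{s+1} ⊗ E_t` may be checked after splitting `E_{s+1}` into `E_1 ⊗ E_s`,
    -- where associativity reduces them to `s` and to 1.
    have inj : Function.Injective (TensorProduct.map (A.β 1 s (add_comm 1 s)).toLinearMap
        (LinearMap.id : A.E t →ₗ[ℂ] A.E t)) :=
      Module.Flat.rTensor_preserves_injective_linearMap _ (A.comult_injective _ _ _)
    constructor
    · apply inj
      apply (TensorProduct.assoc ℂ _ _ _).injective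
      rw [A.assoc 1 s t (add_comm 1 s) e rfl e', (base _ _ e').1]
      simp [(ih t _ rfl).1, (base s _ (add_comm 1 s)).1]
    · apply inj
      apply (TensorProduct.assoc ℂ _ _ _).injective
      rw [A.assoc 1 s t (add_comm 1 s) e rfl e', (base _ _ e').2]
      simp only [mixedTensor, map_add, map_smul, TensorProduct.map_tmul,
        LinearIsometry.coe_toLinearMap, LinearMap.id_apply, (ih t _ rfl).1, (ih t _ rfl).2,
        (base s _ (add_comm 1 s)).1, (base s _ (add_comm 1 s)).2, TensorProduct.add_tmul,
        TensorProduct.tmul_add, ← TensorProduct.smul_tmul', TensorProduct.tmul_smul,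
        TensorProduct.assoc_tmul, PNat.add_coe, PNat.one_coe, pow_succ]
      match_scalars
      all_goals first | ring1 | linear_combination -hp | linear_combination hk s

theorem norm_left_eq_one {p q k : ℂ} {x y : ∀ n, A.E n} (h : Multiplies A p q k x y)
    (hx : ‖x 1‖ = 1) (n : ℕ+) : ‖x n‖ = 1 := by
  induction n with
  | one => exact hx
  | succ n ih =>
    rw [← (A.β n 1 rfl).norm_map, (h n 1).1, TensorProduct.norm_tmul, ih, hx, one_mul]

theorem norm_right_eq_one {x y : ∀ n, A.E n} (h : Multiplies A 0 0 1 x y)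
    (hy : ‖y 1‖ = 1) (n : ℕ+) : ‖y n‖ = 1 := by
  induction n with
  | one => exact hy
  | succ n ih =>
    rw [← (A.β n 1 rfl).norm_map, (h n 1).2]
    simp [mixedTensor, ih, hy]

theorem inner_eq_pow {x y : ∀ n, A.E n} (h : Multiplies A 0 0 1 x y) {a : ℝ}
    (hxy : inner ℂ (x 1) (y 1) = (a : ℂ)) (n : ℕ+) :
    inner ℂ (x n) (y n) = ((a ^ (n : ℕ) : ℝ) : ℂ) := by
  induction n with
  | one => simpa using hxy
  | succ n ih =>
    rw [← (A.β n 1 rfl).inner_map_map, (h n 1).1, (h n 1).2]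
    simp [mixedTensor, ih, hxy, pow_succ]

theorem inner_eq_zero {p q : ℂ} {x y : ∀ n, A.E n} (h : Multiplies A p q 0 x y)
    (hxy : inner ℂ (x 1) (y 1) = 0) (n : ℕ+) : inner ℂ (x n) (y n) = 0 := by
  induction n with
  | one => exact hxy
  | succ n ih =>
    rw [← (A.β n 1 rfl).inner_map_map, (h n 1).1, (h n 1).2]
    simp [mixedTensor, TensorProduct.smul_tmul', ih, hxy, inner_add_right, inner_smul_right]

/-- Pythagoras: `y_n ⊗ x_1` and `x_n ⊗ y_1` are orthogonal because `x_n ⟂ y_n`. -/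
theorem norm_right_sq_succ {p q : ℂ} {x y : ∀ n, A.E n} (h : Multiplies A p q 0 x y)
    (hx : ‖x 1‖ = 1) (hy : ‖y 1‖ = 1) (hxy : inner ℂ (x 1) (y 1) = 0) (n : ℕ+) :
    ‖y (n + 1)‖ ^ 2 = ‖p‖ ^ 2 * ‖y n‖ ^ 2 + ‖q‖ ^ (2 * (n : ℕ)) := by
  rw [← (A.β n 1 rfl).norm_map, (h n 1).2, mixedTensor, zero_smul, add_zero, sq,
    norm_add_sq_eq_norm_sq_add_norm_sq_of_inner_eq_zero (𝕜 := ℂ)]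
  · simp only [TensorProduct.smul_tmul', norm_smul, TensorProduct.norm_tmul, hx, hy,
      norm_left_eq_one A h hx, norm_pow]
    ring
  · simp [TensorProduct.smul_tmul', inner_smul_left, inner_smul_right,
      ← inner_conj_symm (y n) (x n),
      inner_eq_zero A h hxy n]

theorem norm_right_sq_eq_sum {q : ℂ} {x y : ∀ n, A.E n} (h : Multiplies A 1 q 0 x y)
    (hx : ‖x 1‖ = 1) (hy : ‖y 1‖ = 1) (hxy : inner ℂ (x 1) (y 1) = 0) (n : ℕ+) :
    ‖y n‖ ^ 2 = ∑ i ∈ Finset.range n, ‖q‖ ^ (2 * i) := by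
  induction n with
  | one => simp [hy]
  | succ n ih =>
    rw [norm_right_sq_succ A h hx hy hxy, ih, PNat.add_coe, PNat.one_coe, Finset.sum_range_succ]
    simp

theorem norm_right_eq_one_of_right {x y : ∀ n, A.E n} (h : Multiplies A 0 1 0 x y)
    (hx : ‖x 1‖ = 1) (hy : ‖y 1‖ = 1) (hxy : inner ℂ (x 1) (y 1) = 0) (n : ℕ+) : ‖y n‖ = 1 := by
  induction n with
  | one => exact hy
  | succ n ih =>
    have := norm_right_sq_succ A h hx hy hxy n
    exact (pow_eq_one_iff_of_nonneg (norm_nonneg _) two_ne_zero).1 (by simpa using this)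

end DiscreteSubproductSystem

/-! ### Invariants of the range of `β_{r,r}` -/

namespace SubproductSystem

section Rigidity

variable {T : Type*} [AddSemigroup T] (A : SubproductSystem T) {r d : T} (hd : r + r = d)
include hd

/-- The square of `u x + v y` has coefficients `u²` and `v²` on `x ⊗ x` and `y ⊗ y`, which are
absent from the alternating plane. -/
theorem eq_zero_of_alternating_of_square {x y z : A.E r} {xd yd w : A.E d}
    (h : LinearIndependent ℂ ![x, y]) (bx : A.β r r hd xd = x ⊗ₜ[ℂ] y)
    (by' : A.β r r hd yd = y ⊗ₜ[ℂ] x) (bw : A.β r r hd w = z ⊗ₜ[ℂ] z) : z = 0 := by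
  have h2 := A.finrank_eq_two r
  have ind : LinearIndependent ℂ ![xd, yd] := by
    apply linearIndependent_pair_of_map (f := (A.β r r hd).toLinearMap)
    simpa [bx, by'] using linearIndependent_tmul_swap h2 h h
  obtain ⟨α, γ, rfl⟩ := exists_pair_coords (A.finrank_eq_two d) ind w
  obtain ⟨u, v, rfl⟩ := exists_pair_coords h2 h z
  rw [map_add, map_smul, map_smul, bx, by'] at bw
  obtain ⟨⟨e1, -⟩, -, e4⟩ := tensor_coords_inj h2 h h (a := 0) (b := α) (c := γ) (d := 0)
    (a' := u * u) (b' := u * v) (c' := v * u) (d' := v * v) (by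
      refine Eq.trans ?_ (bw.trans ?_)
      · module
      · simp only [TensorProduct.tmul_add, TensorProduct.add_tmul, TensorProduct.tmul_smul,
          ← TensorProduct.smul_tmul']
        module)
  simp [mul_self_eq_zero.1 e1.symm, mul_self_eq_zero.1 e4.symm]

theorem exists_coords_of_normal {p q k : ℂ} (hc : IsNormalCoeff p q k) {x y : A.E r}
    {xd yd : A.E d} (h : LinearIndependent ℂ ![x, y]) (bx : A.β r r hd xd = x ⊗ₜ[ℂ] x)
    (by' : A.β r r hd yd = mixedTensor p q k x y x y) {z z' : A.E r} {u v u' v' : ℂ}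
    (hz : z = u • x + v • y) (hz' : z' = u' • x + v' • y) {p' q' k' : ℂ} {w : A.E d}
    (bw : A.β r r hd w = mixedTensor p' q' k' z z' z z') :
    ∃ γ, p' * (v' * u) + q' * (v * u') + k' * (v' * u') = γ * p ∧
      p' * (u' * v) + q' * (u * v') + k' * (u' * v') = γ * q ∧
      (p' + q') * (v * v') + k' * (v' * v') = γ * k := by
  have h2 := A.finrank_eq_two r
  have ind : LinearIndependent ℂ ![xd, yd] := by
    apply linearIndependent_pair_of_map (f := (A.β r r hd).toLinearMap)
    simpa [bx, by'] using linearIndependent_tmul_self_mixedTensor h2 hc h h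
  obtain ⟨α, γ, rfl⟩ := exists_pair_coords (A.finrank_eq_two d) ind w
  rw [map_add, map_smul, map_smul, bx, by', hz, hz'] at bw
  obtain ⟨⟨-, e2⟩, e3, e4⟩ := tensor_coords_inj h2 h h (a := α) (b := γ * q) (c := γ * p)
    (d := γ * k)
    (a' := (p' + q') * (u * u') + k' * (u' * u'))
    (b' := p' * (u' * v) + q' * (u * v') + k' * (u' * v'))
    (c' := p' * (v' * u) + q' * (v * u') + k' * (v' * u'))
    (d' := (p' + q') * (v * v') + k' * (v' * v')) (by
      refine Eq.trans ?_ (bw.trans ?_)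
      · rw [mixedTensor]; module
      · simp only [mixedTensor, TensorProduct.tmul_add, TensorProduct.add_tmul,
          TensorProduct.tmul_smul, ← TensorProduct.smul_tmul']
        module)
  exact ⟨γ, e3.symm, e2.symm, e4.symm⟩

/-- If `k = 0`, then `x` spans the only line whose squares lie in the range of `β_{r,r}`. -/
theorem coord_eq_zero_of_square {p q : ℂ} (hc : IsNormalCoeff p q 0) {x y : A.E r}
    {xd yd : A.E d} (h : LinearIndependent ℂ ![x, y]) (bx : A.β r r hd xd = x ⊗ₜ[ℂ] x)
    (by' : A.β r r hd yd = mixedTensor p q 0 x y x y) {z : A.E r} {u v : ℂ}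
    (hz : z = u • x + v • y) {w : A.E d} (bw : A.β r r hd w = z ⊗ₜ[ℂ] z) : v = 0 := by
  obtain ⟨γ, -, -, e⟩ := A.exists_coords_of_normal hd hc h bx by' hz hz (p' := 1) (q' := 0)
    (k' := 0) (w := w) (by simp [mixedTensor, bw])
  simpa using e

/-- The line of `x` is intrinsic, and another choice of `y` alters the mixed tensor by a scalar and
a multiple of `x ⊗ x`. Hence the ratio `p : q` is an invariant. -/
theorem cross_eq_of_normal {p q p' q' : ℂ} (hc : IsNormalCoeff p q 0)
    {x y z z' : A.E r} {xd yd zd zd' : A.E d} (h : LinearIndependent ℂ ![x, y])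
    (h' : LinearIndependent ℂ ![z, z'])
    (bx : A.β r r hd xd = x ⊗ₜ[ℂ] x) (by' : A.β r r hd yd = mixedTensor p q 0 x y x y)
    (bz : A.β r r hd zd = z ⊗ₜ[ℂ] z) (bz' : A.β r r hd zd' = mixedTensor p' q' 0 z z' z z') :
    p' * q = q' * p := by
  have h2 := A.finrank_eq_two r
  obtain ⟨u, v, hz⟩ := exists_pair_coords h2 h z
  obtain ⟨u', v', hz'⟩ := exists_pair_coords h2 h z'
  obtain rfl := A.coord_eq_zero_of_square hd hc h bx by' hz bz
  obtain ⟨γ, e1, e2, -⟩ := A.exists_coords_of_normal hd hc h bx by' hz hz' bz'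
  have hu : u ≠ 0 := by
    rintro rfl
    exact h'.ne_zero 0 (by simpa using hz)
  have hv' : v' ≠ 0 := by
    rintro rfl
    have := (LinearIndependent.pair_iff.1 h' u' (-u) (by rw [hz, hz']; module)).2
    exact hu (neg_eq_zero.1 this)
  have := mul_ne_zero hu hv'
  apply mul_left_cancel₀ this
  linear_combination q * e1 - p * e2

theorem not_two_squares_of_normal {p q : ℂ} (hc : IsNormalCoeff p q 0)
    {x y z z' : A.E r} {xd yd zd zd' : A.E d} (h : LinearIndependent ℂ ![x, y])
    (h' : LinearIndependent ℂ ![z, z'])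
    (bx : A.β r r hd xd = x ⊗ₜ[ℂ] x) (by' : A.β r r hd yd = mixedTensor p q 0 x y x y)
    (bz : A.β r r hd zd = z ⊗ₜ[ℂ] z) (bz' : A.β r r hd zd' = z' ⊗ₜ[ℂ] z') : False := by
  have h2 := A.finrank_eq_two r
  obtain ⟨u, v, hz⟩ := exists_pair_coords h2 h z
  obtain ⟨u', v', hz'⟩ := exists_pair_coords h2 h z'
  obtain rfl := A.coord_eq_zero_of_square hd hc h bx by' hz bz
  obtain rfl := A.coord_eq_zero_of_square hd hc h bx by' hz' bz'
  have h0 := LinearIndependent.pair_iff.1 h' u' (-u) (by rw [hz, hz']; module)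
  exact h'.ne_zero 0 (by simp [hz, neg_eq_zero.1 h0.2])

/-- A square `(u x + v y) ⊗ (u x + v y)` in the span of `x ⊗ x` and `y ⊗ y` has `u v = 0`, so only
the lines of `x` and `y` have squares there, and the angle between them is intrinsic. -/
theorem norm_inner_eq_of_squares {x y z z' : A.E r} {xd yd zd zd' : A.E d}
    (h : LinearIndependent ℂ ![x, y]) (h' : LinearIndependent ℂ ![z, z'])
    (hx : ‖x‖ = 1) (hy : ‖y‖ = 1) (hz1 : ‖z‖ = 1) (hz1' : ‖z'‖ = 1)
    (bx : A.β r r hd xd = x ⊗ₜ[ℂ] x) (by' : A.β r r hd yd = y ⊗ₜ[ℂ] y)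
    (bz : A.β r r hd zd = z ⊗ₜ[ℂ] z) (bz' : A.β r r hd zd' = z' ⊗ₜ[ℂ] z') :
    ‖inner ℂ z z'‖ = ‖inner ℂ x y‖ := by
  have h2 := A.finrank_eq_two r
  have aux : ∀ (z : A.E r) (zd : A.E d), A.β r r hd zd = z ⊗ₜ[ℂ] z → ‖z‖ = 1 →
      ∃ u : ℂ, ‖u‖ = 1 ∧ (z = u • x ∨ z = u • y) := by
    intro z zd bz hz1
    obtain ⟨u, v, hz⟩ := exists_pair_coords h2 h z
    obtain ⟨γ, e, -, -⟩ := A.exists_coords_of_normal hd (p := 0) (q := 0) (k := 1)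
      (.inl ⟨rfl, rfl, rfl⟩) h bx (by simpa [mixedTensor] using by') hz hz (p' := 1) (q' := 0)
      (k' := 0) (w := zd) (by simp [mixedTensor, bz])
    have e : v = 0 ∨ u = 0 := by simpa using e
    rcases e with rfl | rfl
    · have hz : z = u • x := by simpa using hz
      exact ⟨u, by rwa [hz, norm_smul, hx, mul_one] at hz1, .inl hz⟩
    · have hz : z = v • y := by simpa using hz
      exact ⟨v, by rwa [hz, norm_smul, hy, mul_one] at hz1, .inr hz⟩
  obtain ⟨u, hu, ez⟩ := aux z zd bz hz1
  obtain ⟨v, hv, ez'⟩ := aux z' zd' bz' hz1'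
  have dep : ∀ t : A.E r, z = u • t → z' = v • t → False := by
    rintro t rfl rfl
    have := (LinearIndependent.pair_iff.1 h' v (-u) (by module)).1
    rw [this, norm_zero] at hv
    exact zero_ne_one hv
  rcases ez with ez | ez <;> rcases ez' with ez' | ez'
  · exact (dep x ez ez').elim
  · rw [ez, ez', inner_smul_left, inner_smul_right, norm_mul, norm_mul, RCLike.norm_conj, hu, hv]
    simp
  · rw [ez, ez', inner_smul_left, inner_smul_right, norm_mul, norm_mul, RCLike.norm_conj, hu, hv,
      norm_inner_symm]
    simp
  · exact (dep y ez ez').elim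

end Rigidity

end SubproductSystem

/-! ### Squares at even times exclude the alternating case -/

namespace DiscreteSubproductSystem

variable (A : SubproductSystem ℕ+)

/-- In the alternating case `x_4` becomes `x ⊗ y ⊗ x ⊗ y` in `E_1` factors, which is `x_2 ⊗ x_2`;
otherwise `x_2` multiplies as it stands. -/
theorem exists_square_two : ∃ z : A.E 2, z ≠ 0 ∧ ∃ w, A.β 2 2 rfl w = z ⊗ₜ[ℂ] z := by
  rcases A.exists_normalized_basis_diagonal (r := 1) (d := 1 + 1) (e := 1 + 1 + 1) rfl rfl
    (by rfl) with ⟨x, y, p, q, k, a, hx, hy, ha, ha', hxy, hc, -, H⟩ | ⟨x, y, h, H⟩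
  · have h := linearIndependent_of_norm_inner_lt_one hx hy (by
      rw [hxy, Complex.norm_real, Real.norm_of_nonneg ha]; exact ha')
    obtain ⟨X, Y, X1, -, hXY⟩ := exists_multiplies A hc h H
    have := norm_left_eq_one A hXY (by rw [X1, hx]) 2
    exact ⟨X 2, fun h0 => by simp [h0] at this, _, (hXY 2 2).1⟩
  · have h2 := A.finrank_eq_two 1
    obtain ⟨x2, y2, bx2, by2⟩ := exists_preimages_of_range_le (A.finrank_eq_two 2)
      (A.comult_injective 1 1 (p := 2) rfl) H
    rw [LinearIsometry.coe_toLinearMap] at bx2 by2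
    have ind2 : LinearIndependent ℂ ![x2, y2] := by
      apply linearIndependent_pair_of_map (f := (A.β 1 1 (p := 2) rfl).toLinearMap)
      simpa [bx2, by2] using linearIndependent_tmul_swap h2 h h
    obtain ⟨x3, y3, bx3, by3⟩ := A.exists_next_alternating_pair (r := 1) (d := 2) (m := 1) (n := 2)
      (l := 3) rfl rfl rfl rfl h h bx2 by2 bx2 by2
    obtain ⟨x4, y4, bx4, by4⟩ := A.exists_next_alternating_pair (r := 1) (d := 2) (m := 2) (n := 3)
      (l := 4) rfl rfl rfl rfl h ind2 bx2 by2 bx3 by3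
    refine ⟨x2, ind2.ne_zero 0, x4, ?_⟩
    have inj : Function.Injective (TensorProduct.map (A.β 1 1 (p := 2) rfl).toLinearMap
        (LinearMap.id : A.E 2 →ₗ[ℂ] A.E 2)) :=
      Module.Flat.rTensor_preserves_injective_linearMap _ (A.comult_injective _ _ _)
    apply inj
    apply (TensorProduct.assoc ℂ _ _ _).injective
    refine (A.assoc 1 1 2 (p := 2) (w := 4) (q := 3) rfl rfl rfl rfl x4).trans ?_
    rw [bx4]
    simp [bx2, by3]

theorem exists_normal_multiplies (hA : ∃ z : A.E 1, z ≠ 0 ∧ ∃ w, A.β 1 1 rfl w = z ⊗ₜ[ℂ] z) :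
    ∃ (x y : ∀ n, A.E n) (p q k : ℂ) (a : ℝ), Multiplies A p q k x y ∧ ‖x 1‖ = 1 ∧ ‖y 1‖ = 1 ∧
      0 ≤ a ∧ a < 1 ∧ inner ℂ (x 1) (y 1) = (a : ℂ) ∧ IsNormalCoeff p q k ∧ (k = 0 → a = 0) := by
  rcases A.exists_normalized_basis_diagonal (r := 1) (d := 1 + 1) (e := 1 + 1 + 1) rfl rfl
    (by rfl) with ⟨x, y, p, q, k, a, hx, hy, ha, ha', hxy, hc, hk, H⟩ | ⟨x, y, h, H⟩
  · have h := linearIndependent_of_norm_inner_lt_one hx hy (by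
      rw [hxy, Complex.norm_real, Real.norm_of_nonneg ha]; exact ha')
    obtain ⟨X, Y, rfl, rfl, hXY⟩ := exists_multiplies A hc h H
    exact ⟨X, Y, p, q, k, a, hXY, hx, hy, ha, ha', hxy, hc, hk⟩
  · obtain ⟨z, hz, w, hw⟩ := hA
    obtain ⟨xd, yd, bx, by'⟩ := exists_preimages_of_range_le (A.finrank_eq_two (1 + 1))
      (A.comult_injective 1 1 rfl) H
    exact (hz (A.eq_zero_of_alternating_of_square rfl h bx by' hw)).elim

theorem Multiplies.smul_right {p q : ℂ} {x y : ∀ n, A.E n} (h : Multiplies A p q 0 x y) (κ : ℂ) :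
    Multiplies A p q 0 x (fun n => κ • y n) := by
  refine fun s t => ⟨(h s t).1, ?_⟩
  rw [map_smul, (h s t).2]
  simp only [mixedTensor, TensorProduct.tmul_smul, ← TensorProduct.smul_tmul']
  module

end DiscreteSubproductSystem

/-! ### Normal forms on sets of rational times, and their limits -/

namespace RationalSubproductSystem

/-- The parameters of the four normal forms. -/
inductive Parameter
  | one (a : ℝ)
  | three (c : ℝ)
  | four
  | five

namespace Parameter

/-- The number of the normal form. -/
def label : Parameter → NormalForm
  | one _ => .one
  | three _ => .three
  | four => .four
  | five => .five

/-- The admissible values of the parameters. -/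
def IsValid : Parameter → Prop
  | one a => 0 ≤ a ∧ a < 1
  | three c => 0 < c
  | four => True
  | five => True

/-- The coefficient of `y_s ⊗ x_t`. -/
def coeffLeft : Parameter → ℂ
  | one _ => 0
  | three _ => 1
  | four => 1
  | five => 0

/-- The coefficient of `y_s ⊗ y_t`. -/
def coeffBoth : Parameter → ℂ
  | one _ => 1
  | three _ => 0
  | four => 0
  | five => 0

/-- The possible coefficients of `x_s ⊗ y_t`. -/
noncomputable def coeffRightSet (s : QPos) : Parameter → Set ℂ
  | one _ => {0}
  | three c => Metric.sphere 0 (c ^ ((s : ℚ) : ℝ))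
  | four => {0}
  | five => {1}

/-- The inner product of `x_t` and `y_t`. -/
noncomputable def innerValue (t : QPos) : Parameter → ℂ
  | one a => ((a ^ ((t : ℚ) : ℝ) : ℝ) : ℂ)
  | three _ => 0
  | four => 0
  | five => 0

open Classical in
/-- The squared norm of `y_t`. -/
noncomputable def normSq (t : QPos) : Parameter → ℝ
  | one _ => 1
  | three c => if c = 1 then ((t : ℚ) : ℝ) else (c ^ (2 * ((t : ℚ) : ℝ)) - 1) / (c ^ 2 - 1)
  | four => 1
  | five => 1

theorem isCompact_coeffRightSet (s : QPos) (D : Parameter) : IsCompact (D.coeffRightSet s) := by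
  cases D
  · exact isCompact_singleton
  · exact isCompact_sphere _ _
  · exact isCompact_singleton
  · exact isCompact_singleton

end Parameter

variable (A : RationalSubproductSystem)

/-- The relations of a normal form, for times in a set `L`. -/
def NormalOn (L : Set QPos) (D : Parameter) (x y : ∀ t, A.E t) (q : QPos → ℂ) : Prop :=
  ∀ s ∈ L, ∀ t ∈ L, ‖x t‖ = 1 ∧ ‖y t‖ ^ 2 = D.normSq t ∧ inner ℂ (x t) (y t) = D.innerValue t ∧
    q t ∈ D.coeffRightSet t ∧ q (s + t) = q s * q t ∧
    A.β s t rfl (x (s + t)) = x s ⊗ₜ[ℂ] x t ∧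
    A.β s t rfl (y (s + t)) = mixedTensor D.coeffLeft (q s) D.coeffBoth (x s) (y s) (x t) (y t)

section Limit

theorem exists_tendsto_of_eventually_norm_le {E : Type*} [NormedAddCommGroup E]
    [InnerProductSpace ℂ E] (hE : Module.finrank ℂ E = 2) (U : Ultrafilter ℕ) {x : ℕ → E} {R : ℝ}
    (h : ∀ᶠ n in U, ‖x n‖ ≤ R) : ∃ z, Tendsto x U (𝓝 z) := by
  have : FiniteDimensional ℂ E := Module.finite_of_finrank_pos (by omega)
  have : ProperSpace E := FiniteDimensional.proper ℂ E
  obtain ⟨z, -, hz⟩ := (isCompact_closedBall (0 : E) R).ultrafilter_le_nhds (U.map x) (by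
    rw [le_principal_iff]
    exact mem_map.2 (h.mono fun n hn => by simpa using hn))
  exact ⟨z, hz⟩

/-- A normal form valid on larger and larger sets of times passes to the limit. -/
theorem exists_normalOn_univ {D : Parameter} {L : ℕ → Set QPos}
    (hL : ∀ t, ∀ᶠ n in atTop, t ∈ L n) (h : ∀ n, ∃ x y q, A.NormalOn (L n) D x y q) :
    ∃ x y q, A.NormalOn Set.univ D x y q := by
  choose x y q hn using h
  -- An ultrafilter makes the bounded vectors and coefficients converge at all times at once; the
  -- relations are closed conditions and survive.
  let U : Ultrafilter ℕ := hyperfilter ℕ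
  have hU : ∀ t, ∀ᶠ n in (U : Filter ℕ), t ∈ L n := fun t => Nat.hyperfilter_le_atTop (hL t)
  have hx : ∀ t, ∃ z, Tendsto (fun n => x n t) U (𝓝 z) := fun t =>
    exists_tendsto_of_eventually_norm_le (A.finrank_eq_two t) U (R := 1)
      ((hU t).mono fun n ht => (hn n t ht t ht).1.le)
  have hy : ∀ t, ∃ z, Tendsto (fun n => y n t) U (𝓝 z) := fun t =>
    exists_tendsto_of_eventually_norm_le (A.finrank_eq_two t) U (R := √(D.normSq t))
      ((hU t).mono fun n ht => Real.le_sqrt_of_sq_le (hn n t ht t ht).2.1.le)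
  have hq : ∀ t, ∃ z ∈ D.coeffRightSet t, Tendsto (fun n => q n t) U (𝓝 z) := by
    intro t
    obtain ⟨z, hz, hz'⟩ := (D.isCompact_coeffRightSet t).ultrafilter_le_nhds
      (U.map fun n => q n t) (by
        rw [le_principal_iff]
        exact mem_map.2 ((hU t).mono fun n ht => (hn n t ht t ht).2.2.2.1))
    exact ⟨z, hz, hz'⟩
  choose X hX using hx
  choose Y hY using hy
  choose Q hQK hQ using hq
  have tmul : ∀ {s t : QPos} {u : ℕ → A.E s} {v : ℕ → A.E t} {u' v'},
      Tendsto u U (𝓝 u') → Tendsto v U (𝓝 v') →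
      Tendsto (fun n => u n ⊗ₜ[ℂ] v n) U (𝓝 (u' ⊗ₜ[ℂ] v')) := fun hu hv =>
    (TensorProduct.continuous_tmul.tendsto _).comp (hu.prodMk_nhds hv)
  refine ⟨X, Y, Q, fun s _ t _ => ?_⟩
  have hst : ∀ᶠ n in (U : Filter ℕ), s ∈ L n ∧ t ∈ L n := (hU s).and (hU t)
  refine ⟨?_, ?_, ?_, hQK t, ?_, ?_, ?_⟩
  · exact tendsto_nhds_unique_of_eventuallyEq (hX t).norm tendsto_const_nhds
      (hst.mono fun n h => (hn n s h.1 t h.2).1)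
  · exact tendsto_nhds_unique_of_eventuallyEq ((hY t).norm.pow 2) tendsto_const_nhds
      (hst.mono fun n h => (hn n s h.1 t h.2).2.1)
  · exact tendsto_nhds_unique_of_eventuallyEq ((hX t).inner (hY t)) tendsto_const_nhds
      (hst.mono fun n h => (hn n s h.1 t h.2).2.2.1)
  · exact tendsto_nhds_unique_of_eventuallyEq (hQ (s + t)) ((hQ s).mul (hQ t))
      (hst.mono fun n h => (hn n s h.1 t h.2).2.2.2.2.1)
  · exact tendsto_nhds_unique_of_eventuallyEq
      (((A.β s t rfl).continuous.tendsto _).comp (hX (s + t))) (tmul (hX s) (hX t))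
      (hst.mono fun n h => (hn n s h.1 t h.2).2.2.2.2.2.1)
  · refine tendsto_nhds_unique_of_eventuallyEq
      (((A.β s t rfl).continuous.tendsto _).comp (hY (s + t))) ?_
      (hst.mono fun n h => (hn n s h.1 t h.2).2.2.2.2.2.2)
    simp only [mixedTensor, TensorProduct.smul_tmul']
    exact ((tmul ((hY s).const_smul _) (hX t)).add (tmul ((hQ s).smul (hX s)) (hY t))).add
      (tmul ((hY s).const_smul _) (hY t))

end Limit

end RationalSubproductSystem

/-! ### The parameter is determined at time 1 -/

namespace RationalSubproductSystem

theorem Parameter.normSq_one {D : Parameter} (hD : D.IsValid) : D.normSq 1 = 1 := by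
  cases D with
  | three c =>
    simp only [normSq, Positive.val_one, Rat.cast_one, mul_one]
    split_ifs with h
    · rfl
    · have hc : 0 < c := hD
      have : c ^ 2 - 1 ≠ 0 := fun h0 => h (by nlinarith)
      rw [show (2 : ℝ) = ((2 : ℕ) : ℝ) by norm_num, Real.rpow_natCast, div_self this]
  | _ => rfl

theorem Parameter.isNormalCoeff {D : Parameter} {s : QPos} {q : ℂ} (hq : q ∈ D.coeffRightSet s) :
    IsNormalCoeff D.coeffLeft q D.coeffBoth := by
  cases D with
  | one a => exact .inl ⟨rfl, hq, rfl⟩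
  | three c => exact .inr (.inl ⟨rfl, rfl⟩)
  | four => exact .inr (.inl ⟨rfl, rfl⟩)
  | five => exact .inr (.inr ⟨rfl, hq, rfl⟩)

theorem Parameter.norm_innerValue_one_lt {D : Parameter} (hD : D.IsValid) :
    ‖D.innerValue 1‖ < 1 := by
  cases D with
  | one a =>
    have h0 : 0 ≤ a := hD.1
    have h1 : a < 1 := hD.2
    simpa [innerValue, abs_of_nonneg h0] using h1
  | _ => simp [innerValue]

variable {A : RationalSubproductSystem}

theorem NormalOn.at_one {L : Set QPos} {D : Parameter} {x y : ∀ t, A.E t} {q : QPos → ℂ}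
    (hD : D.IsValid) (h : A.NormalOn L D x y q) (h1 : (1 : QPos) ∈ L) :
    ‖x 1‖ = 1 ∧ ‖y 1‖ = 1 ∧ inner ℂ (x 1) (y 1) = D.innerValue 1 ∧
      q 1 ∈ D.coeffRightSet 1 ∧ LinearIndependent ℂ ![x 1, y 1] ∧
      IsNormalCoeff D.coeffLeft (q 1) D.coeffBoth ∧
      A.β 1 1 rfl (x (1 + 1)) = x 1 ⊗ₜ[ℂ] x 1 ∧
      A.β 1 1 rfl (y (1 + 1)) =
        mixedTensor D.coeffLeft (q 1) D.coeffBoth (x 1) (y 1) (x 1) (y 1) := by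
  obtain ⟨hx, hy, hxy, hq, -, bx, by'⟩ := h 1 h1 1 h1
  have hy : ‖y 1‖ = 1 := by
    rw [Parameter.normSq_one hD] at hy
    exact (pow_eq_one_iff_of_nonneg (norm_nonneg _) two_ne_zero).1 hy
  exact ⟨hx, hy, hxy, hq, linearIndependent_of_norm_inner_lt_one hx hy
    (by rw [hxy]; exact Parameter.norm_innerValue_one_lt hD), Parameter.isNormalCoeff hq, bx, by'⟩

/-- The parameter of a normal form is determined by the system. -/
theorem NormalOn.parameter_eq {L L' : Set QPos} {D D' : Parameter} {x y x' y' : ∀ t, A.E t}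
    {q q' : QPos → ℂ} (hD : D.IsValid) (hD' : D'.IsValid) (h : A.NormalOn L D x y q)
    (h' : A.NormalOn L' D' x' y' q') (h1 : (1 : QPos) ∈ L) (h1' : (1 : QPos) ∈ L') : D = D' := by
  obtain ⟨hx, hy, hxy, hq, hi, hc, bx, by'⟩ := h.at_one hD h1
  obtain ⟨hz, hw, hzw, hq', hi', hc', bz, bw⟩ := h'.at_one hD' h1'
  have cross : D.coeffBoth = 0 → D'.coeffBoth = 0 →
      D'.coeffLeft * q 1 = q' 1 * D.coeffLeft := by
    intro e e'
    rw [e] at hc by'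
    rw [e'] at bw
    exact A.cross_eq_of_normal rfl hc hi hi' bx by' bz bw
  -- Form 1 has squares on two lines, the other forms on one only. Forms 3, 4 and 5 are then told
  -- apart by the ratio of left to right coefficients.
  have two : ∀ {D D' : Parameter} {x y x' y' : ∀ t, A.E t} {q q' : ℂ}, D.coeffBoth = 0 →
      IsNormalCoeff D.coeffLeft q D.coeffBoth →
      LinearIndependent ℂ ![x 1, y 1] → LinearIndependent ℂ ![x' 1, y' 1] →
      A.β 1 1 rfl (x (1 + 1)) = x 1 ⊗ₜ[ℂ] x 1 →
      A.β 1 1 rfl (y (1 + 1)) =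
        mixedTensor D.coeffLeft q D.coeffBoth (x 1) (y 1) (x 1) (y 1) →
      A.β 1 1 rfl (x' (1 + 1)) = x' 1 ⊗ₜ[ℂ] x' 1 →
      A.β 1 1 rfl (y' (1 + 1)) = mixedTensor 0 q' 1 (x' 1) (y' 1) (x' 1) (y' 1) → q' = 0 →
      False := by
    intro D D' x y x' y' q q' e hc hi hi' bx by' bz bw hq'
    rw [e] at hc by'
    subst hq'
    exact A.not_two_squares_of_normal rfl hc hi hi' bx by' bz (by rw [bw]; simp [mixedTensor])
  cases D with
  | one a =>
    have h0 : q 1 = 0 := hq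
    cases D' with
    | one a' =>
      have h0' : q' 1 = 0 := hq'
      have := A.norm_inner_eq_of_squares rfl hi hi' hx hy hz hw bx
        (by rw [by', h0]; simp [mixedTensor, Parameter.coeffLeft, Parameter.coeffBoth]) bz
        (by rw [bw, h0']; simp [mixedTensor, Parameter.coeffLeft, Parameter.coeffBoth])
      rw [hxy, hzw] at this
      have e : a' = a := by
        simpa [Parameter.innerValue, abs_of_nonneg hD.1, abs_of_nonneg hD'.1] using this
      rw [e]
    | three c => exact (two (D' := .one a) rfl hc' hi' hi bz bw bx by' h0).elim
    | four => exact (two (D' := .one a) rfl hc' hi' hi bz bw bx by' h0).elim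
    | five => exact (two (D' := .one a) rfl hc' hi' hi bz bw bx by' h0).elim
  | three c =>
    have hc0 : 0 < c := hD
    have nq : ‖q 1‖ = c := by simpa [Parameter.coeffRightSet] using hq
    cases D' with
    | one a' => exact (two (D' := .one a') rfl hc hi hi' bx by' bz bw hq').elim
    | three c' =>
      have nq' : ‖q' 1‖ = c' := by simpa [Parameter.coeffRightSet] using hq'
      have e : q 1 = q' 1 := by simpa [Parameter.coeffLeft] using cross rfl rfl
      rw [← nq, ← nq', e]
    | four =>
      have e : q 1 = q' 1 := by simpa [Parameter.coeffLeft] using cross rfl rfl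
      have h0' : q' 1 = 0 := hq'
      rw [e, h0', norm_zero] at nq
      exact (hc0.ne nq).elim
    | five =>
      have e : 0 = q' 1 := by simpa [Parameter.coeffLeft] using cross rfl rfl
      have h0' : q' 1 = 1 := hq'
      simp [h0'] at e
  | four =>
    have h0 : q 1 = 0 := hq
    cases D' with
    | one a' => exact (two (D' := .one a') rfl hc hi hi' bx by' bz bw hq').elim
    | three c =>
      have hc0 : 0 < c := hD'
      have nq' : ‖q' 1‖ = c := by simpa [Parameter.coeffRightSet] using hq'
      have e : q 1 = q' 1 := by simpa [Parameter.coeffLeft] using cross rfl rfl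
      rw [← e, h0, norm_zero] at nq'
      exact (hc0.ne nq').elim
    | four => rfl
    | five =>
      have e : 0 = q' 1 := by simpa [Parameter.coeffLeft] using cross rfl rfl
      have h0' : q' 1 = 1 := hq'
      simp [h0'] at e
  | five =>
    have h0 : q 1 = 1 := hq
    cases D' with
    | one a' => exact (two (D' := .one a') rfl hc hi hi' bx by' bz bw hq').elim
    | three c =>
      have e : q 1 = 0 := by simpa [Parameter.coeffLeft] using cross rfl rfl
      simp [h0] at e
    | four =>
      have e : q 1 = 0 := by simpa [Parameter.coeffLeft] using cross rfl rfl
      simp [h0] at e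
    | five => rfl

theorem NormalOn.isBasis {D : Parameter} (hD : D.IsValid) {x y : ∀ t, A.E t} {q : QPos → ℂ}
    (h : A.NormalOn Set.univ D x y q) : A.IsBasis x y D.label := by
  cases D with
  | one a =>
    refine ⟨a, hD.1, hD.2, fun s t => ?_⟩
    obtain ⟨hx, hy, hxy, -, -, bx, by'⟩ := h s trivial t trivial
    have hq : q s = 0 := (h s trivial s trivial).2.2.2.1
    refine ⟨hx, (pow_eq_one_iff_of_nonneg (norm_nonneg _) two_ne_zero).1 hy, hxy, bx, ?_⟩
    rw [by', hq]
    simp [mixedTensor, Parameter.coeffLeft, Parameter.coeffBoth]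
  | three c =>
    have hc : 0 < c := hD
    have hcs : ∀ s : QPos, ((c ^ ((s : ℚ) : ℝ) : ℝ) : ℂ) ≠ 0 := fun s =>
      Complex.ofReal_ne_zero.2 (Real.rpow_pos_of_pos hc _).ne'
    refine ⟨c, fun t => q t / ((c ^ ((t : ℚ) : ℝ) : ℝ) : ℂ), hc, fun s t => ?_⟩
    obtain ⟨hx, hy, hxy, hq, hqq, bx, by'⟩ := h s trivial t trivial
    refine ⟨?_, ?_, hx, hxy, hy, bx, ?_⟩
    · have hq : ‖q t‖ = c ^ ((t : ℚ) : ℝ) := by simpa [Parameter.coeffRightSet] using hq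
      rw [norm_div, hq, Complex.norm_real, Real.norm_of_nonneg (Real.rpow_nonneg hc.le _),
        div_self (Real.rpow_pos_of_pos hc _).ne']
    · have : ((c ^ (((s + t : QPos) : ℚ) : ℝ) : ℝ) : ℂ) =
          ((c ^ ((s : ℚ) : ℝ) : ℝ) : ℂ) * ((c ^ ((t : ℚ) : ℝ) : ℝ) : ℂ) := by
        rw [← Complex.ofReal_mul, ← Real.rpow_add hc, Positive.coe_add, Rat.cast_add]
      simp only [hqq, this]
      rw [div_mul_div_comm]
    · rw [by', mul_div_cancel₀ _ (hcs s)]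
      simp [mixedTensor, Parameter.coeffLeft, Parameter.coeffBoth]
  | four =>
    intro s t
    obtain ⟨hx, hy, hxy, -, -, bx, by'⟩ := h s trivial t trivial
    have hq : q s = 0 := (h s trivial s trivial).2.2.2.1
    refine ⟨hx, (pow_eq_one_iff_of_nonneg (norm_nonneg _) two_ne_zero).1 hy, hxy, bx, ?_⟩
    rw [by', hq]
    simp [mixedTensor, Parameter.coeffLeft, Parameter.coeffBoth]
  | five =>
    intro s t
    obtain ⟨hx, hy, hxy, -, -, bx, by'⟩ := h s trivial t trivial
    have hq : q s = 1 := (h s trivial s trivial).2.2.2.1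
    refine ⟨hx, (pow_eq_one_iff_of_nonneg (norm_nonneg _) two_ne_zero).1 hy, hxy, bx, ?_⟩
    rw [by', hq]
    simp [mixedTensor, Parameter.coeffLeft, Parameter.coeffBoth]

theorem IsBasis.exists_normalOn {k : NormalForm} {x y : ∀ t, A.E t} (h : A.IsBasis x y k) :
    ∃ D : Parameter, D.label = k ∧ D.IsValid ∧ ∃ q, A.NormalOn Set.univ D x y q := by
  cases k with
  | one =>
    obtain ⟨a, ha, ha', h⟩ := h
    refine ⟨.one a, rfl, ⟨ha, ha'⟩, fun _ => 0, fun s _ t _ => ?_⟩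
    obtain ⟨hx, hy, hxy, bx, by'⟩ := h s t
    refine ⟨hx, by rw [hy]; exact one_pow 2, hxy, rfl, by simp, bx, ?_⟩
    rw [by']
    simp [mixedTensor, Parameter.coeffLeft, Parameter.coeffBoth]
  | three =>
    obtain ⟨c, η, hc, h⟩ := h
    refine ⟨.three c, rfl, hc, fun t => ((c ^ ((t : ℚ) : ℝ) : ℝ) : ℂ) * η t, fun s _ t _ => ?_⟩
    obtain ⟨hη, hηη, hx, hxy, hy, bx, by'⟩ := h s t
    refine ⟨hx, hy, hxy, ?_, ?_, bx, ?_⟩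
    · simp [Parameter.coeffRightSet, hη, abs_of_nonneg (Real.rpow_nonneg hc.le _)]
    · simp only [hηη, Positive.coe_add, Rat.cast_add, Real.rpow_add hc, Complex.ofReal_mul]
      ring
    · rw [by']
      simp [mixedTensor, Parameter.coeffLeft, Parameter.coeffBoth]
  | four =>
    refine ⟨.four, rfl, trivial, fun _ => 0, fun s _ t _ => ?_⟩
    obtain ⟨hx, hy, hxy, bx, by'⟩ := h s t
    refine ⟨hx, by rw [hy]; exact one_pow 2, hxy, rfl, by simp, bx, ?_⟩
    rw [by']
    simp [mixedTensor, Parameter.coeffLeft, Parameter.coeffBoth]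
  | five =>
    refine ⟨.five, rfl, trivial, fun _ => 1, fun s _ t _ => ?_⟩
    obtain ⟨hx, hy, hxy, bx, by'⟩ := h s t
    refine ⟨hx, by rw [hy]; exact one_pow 2, hxy, rfl, by simp, bx, ?_⟩
    rw [by']
    simp [mixedTensor, Parameter.coeffLeft, Parameter.coeffBoth]

end RationalSubproductSystem

/-! ### From lattices to all positive rationals -/

theorem Function.Injective.exists_dependent_extension {ι κ : Type*} {S : κ → Type*}
    [∀ t, Inhabited (S t)] {f : ι → κ} (hf : Function.Injective f) (x : ∀ n, S (f n)) :
    ∃ X : ∀ t, S t, ∀ n, X (f n) = x n := by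
  classical
  refine ⟨fun t => if h : ∃ n, f n = t then h.choose_spec ▸ x h.choose else default, fun n => ?_⟩
  have h : ∃ m, f m = f n := ⟨n, rfl⟩
  have key : ∀ m (e : f m = f n), (e ▸ x m : S (f n)) = x n := by
    intro m e
    obtain rfl := hf e
    rfl
  simp only [h, dite_true]
  exact key _ _

theorem QPos.multiples_injective (r : QPos) : Function.Injective r.multiples := by
  intro m n h
  have h : (m : ℚ) * (r : ℚ) = (n : ℚ) * (r : ℚ) := congrArg Subtype.val h
  have := mul_right_cancel₀ r.2.ne' h
  exact PNat.coe_injective (by exact_mod_cast this)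

namespace RationalSubproductSystem

open DiscreteSubproductSystem

variable (A : RationalSubproductSystem)

theorem exists_square (r : QPos) {p : QPos} (h : r + r = p) :
    ∃ z : A.E r, z ≠ 0 ∧ ∃ w, A.β r r h w = z ⊗ₜ[ℂ] z := by
  -- Divisibility of time is used here: `r` is an even time of the lattice of `r / 2`.
  obtain ⟨s, rfl⟩ : ∃ s : QPos, s.multiples 2 = r :=
    ⟨⟨r / 2, half_pos r.2⟩, Subtype.ext (mul_div_cancel₀ _ two_ne_zero)⟩
  obtain rfl : p = s.multiples (2 + 2) := by rw [← h, map_add]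
  exact exists_square_two (A.restrict s)

theorem exists_normalOn_multiples (r : QPos) (D : Parameter) (x y : ∀ n, (A.restrict r).E n)
    {q : ℂ} (h : Multiplies (A.restrict r) D.coeffLeft q D.coeffBoth x y)
    (hx : ∀ n, ‖x n‖ = 1) (hy : ∀ n, ‖y n‖ ^ 2 = D.normSq (r.multiples n))
    (hxy : ∀ n, inner ℂ (x n) (y n) = D.innerValue (r.multiples n))
    (hq : ∀ n : ℕ+, q ^ (n : ℕ) ∈ D.coeffRightSet (r.multiples n)) :
    ∃ X Y Q, A.NormalOn (Set.range r.multiples) D X Y Q := by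
  -- The values off the lattice are immaterial: the relations involve only lattice times and their
  -- sums.
  have : ∀ t, Inhabited (A.E t) := fun t => ⟨0⟩
  obtain ⟨X, hX⟩ := r.multiples_injective.exists_dependent_extension (S := A.E) x
  obtain ⟨Y, hY⟩ := r.multiples_injective.exists_dependent_extension (S := A.E) y
  obtain ⟨Q, hQ⟩ := r.multiples_injective.exists_dependent_extension (S := fun _ => ℂ)
    (fun n : ℕ+ => q ^ (n : ℕ))
  refine ⟨X, Y, Q, ?_⟩
  rintro _ ⟨m, rfl⟩ _ ⟨n, rfl⟩
  have named : ∀ (s t p : QPos) (e : s + t = p) (Z : ∀ t, A.E t) (w),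
      A.β s t e (Z p) = w → A.β s t rfl (Z (s + t)) = w := by
    rintro s t p rfl Z w h
    exact h
  rw [hX, hX, hY, hY, hQ, hQ]
  refine ⟨hx n, hy n, hxy n, hq n, by rw [← map_add, hQ, PNat.add_coe, pow_add], ?_, ?_⟩
  · apply named _ _ (r.multiples (m + n)) (map_add _ _ _).symm
    rw [hX]
    exact (h m n).1
  · apply named _ _ (r.multiples (m + n)) (map_add _ _ _).symm
    rw [hY]
    exact (h m n).2

theorem exists_parameter_normalOn_multiples (r : QPos) {N : ℕ+} (hr : r.multiples N = 1) :
    ∃ D : Parameter, D.IsValid ∧ ∃ x y q, A.NormalOn (Set.range r.multiples) D x y q := by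
  have hNr : ((N : ℕ) : ℝ) * ((r : ℚ) : ℝ) = 1 := by
    have : ((N : ℕ) : ℚ) * (r : ℚ) = 1 := congrArg Subtype.val hr
    exact_mod_cast this
  have cast : ∀ n : ℕ+, (((r.multiples n : QPos) : ℚ) : ℝ) = (n : ℕ) * ((r : ℚ) : ℝ) := by
    intro n
    change (((n : ℕ) * (r : ℚ) : ℚ) : ℝ) = _
    push_cast
    rfl
  -- Parameters are measured at time 1, the `N`-th lattice point, so a discrete base `b` becomes `b
  -- ^ N` and `b ^ n` is its power at time `n r`.
  have rpow : ∀ (b : ℝ) (n : ℕ+), 0 ≤ b →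
      (b ^ (N : ℕ)) ^ (((r.multiples n : QPos) : ℚ) : ℝ) = b ^ (n : ℕ) := by
    intro b n hb
    rw [cast, ← Real.rpow_natCast, ← Real.rpow_mul hb,
      show ((N : ℕ) : ℝ) * ((n : ℕ) * ((r : ℚ) : ℝ)) = (n : ℕ) by linear_combination (n : ℝ) * hNr,
      Real.rpow_natCast]
  obtain ⟨x, y, p, q, k, a, h, hx, hy, ha, ha', hxy, hc, hk⟩ :=
    exists_normal_multiplies (A.restrict r) (A.exists_square (r.multiples 1) (map_add _ _ _).symm)
  have hxn := norm_left_eq_one _ h hx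
  have ortho : k = 0 → inner ℂ (x 1) (y 1) = 0 := fun h0 => by rw [hxy, hk h0]; simp
  rcases hc with ⟨rfl, rfl, rfl⟩ | ⟨rfl, rfl⟩ | ⟨rfl, rfl, rfl⟩
  · refine ⟨.one (a ^ (N : ℕ)), ⟨by positivity, pow_lt_one₀ ha ha' N.ne_zero⟩,
      A.exists_normalOn_multiples r _ x y h hxn (fun n => ?_) (fun n => ?_) (fun n => ?_)⟩
    · rw [norm_right_eq_one _ h hy]; exact one_pow 2
    · rw [inner_eq_pow _ h hxy, ← rpow a n ha]; rfl
    · rw [zero_pow n.ne_zero]; rfl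
  · have hxyn := inner_eq_zero _ h (ortho rfl)
    by_cases hq : q = 0
    · subst hq
      refine ⟨.four, trivial,
        A.exists_normalOn_multiples r _ x y h hxn (fun n => ?_) hxyn (fun n => ?_)⟩
      · rw [norm_right_sq_eq_sum _ h hx hy (ortho rfl), ← Nat.succ_pred_eq_of_pos n.pos,
          Finset.sum_range_succ']
        simp [Parameter.normSq]
      · rw [zero_pow n.ne_zero]; rfl
    · have hq0 : 0 < ‖q‖ := norm_pos_iff.2 hq
      have sq : ∀ n : ℕ+, ‖y n‖ ^ 2 = ∑ i ∈ Finset.range n, (‖q‖ ^ 2) ^ i := fun n => by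
        rw [norm_right_sq_eq_sum _ h hx hy (ortho rfl)]
        simp only [pow_mul]
      -- Division by `‖y N‖` gives `y` norm 1 at time 1; the squared norms are then quotients of
      -- geometric sums with `n` and `N` terms.
      refine ⟨.three (‖q‖ ^ (N : ℕ)), pow_pos hq0 _,
        A.exists_normalOn_multiples r _ x (fun n => ((‖y N‖ : ℂ)⁻¹) • y n)
          (h.smul_right _ _) hxn (fun n => ?_) (fun n => ?_) (fun n => ?_)⟩
      · rw [norm_smul, norm_inv, Complex.norm_real, norm_norm, mul_pow, inv_pow, sq n, sq N,
          Parameter.normSq]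
        have hone : ‖q‖ ^ (N : ℕ) = 1 ↔ ‖q‖ = 1 :=
          pow_eq_one_iff_of_nonneg hq0.le N.ne_zero
        split_ifs with h1
        · rw [hone.1 h1, cast]
          have : ((N : ℕ) : ℝ) ≠ 0 := by simp
          simp only [one_pow, Finset.sum_const, Finset.card_range, nsmul_eq_mul, mul_one]
          rw [inv_mul_eq_iff_eq_mul₀ this]
          linear_combination -(n : ℝ) * hNr
        · have hb : ‖q‖ ^ 2 ≠ 1 := fun e => h1 (hone.2
            ((pow_eq_one_iff_of_nonneg hq0.le two_ne_zero).1 e))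
          have hb' : ‖q‖ ^ 2 - 1 ≠ 0 := sub_ne_zero.2 hb
          have hc : (‖q‖ ^ (N : ℕ)) ^ (2 * (((r.multiples n : QPos) : ℚ) : ℝ)) =
              (‖q‖ ^ 2) ^ (n : ℕ) := by
            rw [mul_comm, Real.rpow_mul (by positivity), rpow _ _ hq0.le, Real.rpow_two,
              pow_right_comm]
          rw [geom_sum_eq hb, geom_sum_eq hb, inv_div, div_mul_div_comm, mul_comm,
            mul_div_mul_right _ _ hb', hc, pow_right_comm ‖q‖ 2 N]
      · rw [inner_smul_right, hxyn, mul_zero]; rfl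
      · simp only [Parameter.coeffRightSet]
        rw [mem_sphere_zero_iff_norm, norm_pow, rpow _ _ hq0.le]
  · have hxyn := inner_eq_zero _ h (ortho rfl)
    refine ⟨.five, trivial,
      A.exists_normalOn_multiples r _ x y h hxn (fun n => ?_) hxyn (fun n => ?_)⟩
    · rw [norm_right_eq_one_of_right _ h hx hy (ortho rfl)]; exact one_pow 2
    · rw [one_pow]; rfl

/-- The rational number `1 / n!`. -/
def invFactorial (n : ℕ) : QPos := ⟨1 / n.factorial, by positivity⟩

theorem eventually_mem_range_multiples_invFactorial (t : QPos) :
    ∀ᶠ n in atTop, t ∈ Set.range (invFactorial n).multiples := by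
  filter_upwards [eventually_ge_atTop (t : ℚ).den] with n hn
  obtain ⟨k, hk⟩ := Nat.dvd_factorial (t : ℚ).den_pos hn
  have hk0 : 0 < k := Nat.pos_of_ne_zero fun h0 => n.factorial_ne_zero (by rw [hk, h0, mul_zero])
  have hnum : 0 < (t : ℚ).num := Rat.num_pos.2 t.2
  refine ⟨⟨(t : ℚ).num.toNat * k, Nat.mul_pos (by omega) hk0⟩, Subtype.ext ?_⟩
  change (((t : ℚ).num.toNat * k : ℕ) : ℚ) * (1 / (n.factorial : ℚ)) = (t : ℚ)
  have hcast : (((t : ℚ).num.toNat : ℕ) : ℚ) = ((t : ℚ).num : ℚ) := by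
    exact_mod_cast Int.toNat_of_nonneg hnum.le
  have hd : ((t : ℚ).den : ℚ) ≠ 0 := by simp
  have hk' : (k : ℚ) ≠ 0 := by exact_mod_cast hk0.ne'
  rw [hk, Nat.cast_mul, Nat.cast_mul, hcast, mul_one_div, mul_div_mul_right _ _ hk',
    Rat.num_div_den]

theorem exists_parameter_normalOn_univ :
    ∃ D : Parameter, D.IsValid ∧ ∃ x y q, A.NormalOn Set.univ D x y q := by
  have unit : ∀ n, (invFactorial n).multiples ⟨n.factorial, n.factorial_pos⟩ = 1 := fun n =>
    Subtype.ext (mul_one_div_cancel (by exact_mod_cast n.factorial_ne_zero))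
  choose D hD hDn using fun n => A.exists_parameter_normalOn_multiples _ (unit n)
  -- All the lattices contain time 1, so their parameters agree and the limit theorem applies with
  -- `D 0`.
  refine ⟨D 0, hD 0, A.exists_normalOn_univ eventually_mem_range_multiples_invFactorial
    fun n => ?_⟩
  obtain ⟨x, y, q, h⟩ := hDn n
  obtain ⟨x', y', q', h'⟩ := hDn 0
  rw [h'.parameter_eq (hD 0) (hD n) h ⟨_, unit 0⟩ ⟨_, unit n⟩]
  exact ⟨x, y, q, h⟩

theorem label_eq_of_isBasis {k k' : NormalForm} {x y x' y' : ∀ t, A.E t} (h : A.IsBasis x y k)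
    (h' : A.IsBasis x' y' k') : k = k' := by
  obtain ⟨D, rfl, hD, q, hq⟩ := h.exists_normalOn
  obtain ⟨D', rfl, hD', q', hq'⟩ := h'.exists_normalOn
  rw [hq.parameter_eq hD hD' hq' trivial trivial]

/-- Since 1 is odd, a type 2 basis makes the range of `β_{r,r}` alternating, whereas `exists_square`
provides a nonzero square in it. -/
theorem not_isType2 (r : QPos) (x y : ∀ n, (A.restrict r).E n) : ¬ (A.restrict r).IsType2 x y := by
  rintro ⟨a, ha, ha', h⟩
  obtain ⟨hx, hy, hxy, bx, by'⟩ := h 1 1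
  have ind := linearIndependent_of_norm_inner_lt_one hx hy (by
    rw [hxy]; simpa [abs_of_nonneg ha] using ha')
  obtain ⟨z, hz, w, hw⟩ := A.exists_square (r.multiples 1) (map_add r.multiples 1 1).symm
  exact hz ((A.restrict r).eq_zero_of_alternating_of_square (r := 1) (d := 1 + 1) rfl ind
    (by simpa using bx) (by simpa using by') hw)

end RationalSubproductSystem

/-- Every rational-time subproduct system of two-dimensional Hilbert spaces has vectors in exactly one
of the four normal forms; the form depends only on the system; and no restriction of the system to a
lattice of positive integer multiples of a positive rational has a basis of type `𝓔₂`. -/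
theorem theorem3p1 (A : RationalSubproductSystem) :
    (∃ x y : ∀ t, A.E t, ∃! k : RationalSubproductSystem.NormalForm, A.IsBasis x y k) ∧
    (∀ (k k' : RationalSubproductSystem.NormalForm) (x y x' y' : ∀ t, A.E t),
      A.IsBasis x y k → A.IsBasis x' y' k' → k = k') ∧
    (∀ r : QPos, ¬ ∃ x y : ∀ n, (A.restrict r).E n, (A.restrict r).IsType2 x y) := by
  refine ⟨?_, fun k k' x y x' y' h h' => A.label_eq_of_isBasis h h', ?_⟩
  · obtain ⟨D, hD, x, y, q, h⟩ := A.exists_parameter_normalOn_univ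
    exact ⟨x, y, D.label, h.isBasis hD, fun k hk => A.label_eq_of_isBasis hk (h.isBasis hD)⟩
  · rintro r ⟨x, y, h⟩
    exact A.not_isType2 r x y h
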